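/- Let $\theta^*\in\mathbb{R}^d$ and $Y_t=\varphi_t^{\mathrm T}\theta^*+W_t$, $t\ge 1$, with random regressors $\varphi_t\in\mathbb{R}^d$ and real noises $W_t$; let $\psi_t\in\mathbb{R}^d$ be random co-regressors and $R_n\in\mathbb{R}^{d\times d}$ random matrices. Let $\ell\in\mathbb{N}$, $\kappa<\infty$, and call a sequence $\{X_t\}$ $\ell$-independent if, for every $t$, $X_t$ is independent of the family $\{X_k\}_{|t-k|\ge\ell}$. Assume: (A1) $\{W_t\}$ is i.i.d. with finite fourth moment. (A2) $\{\varphi_t\}$ is $\ell$-independent and $\mathbb{E}\|\varphi_t\|^4\le\kappa$ for all $t$. (A3) $\{\psi_t\}$ is $\ell$-independent, $\mathbb{E}\|\psi_t\|^4\le\kappa$ for all $t$, the sequence $\{\psi_t\}$ is independent of the sequence $\{W_t\}$, and $\mathbb{E}[\psi_tW_t]=0$ for all $t$. (A4) If $|i-j|\ge\ell$, then $\psi_i$ and $\varphi_j$ are independent and $\mathbb{E}[\psi_i\varphi_j^{\mathrm T}]=0$; if $|i-j|<\ell$, then $\mathbb{E}[\psi_{i,k}^4\varphi_{j,l}^4]\le\kappa$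 for all coordinates $k,l$; and almost surely $V_n=\frac1n\sum_{t=1}^n\psi_t\varphi_t^{\mathrm T}\to V$, where $V$ is positive definite ($x^{\mathrm T}Vx>0$ for all $x\neq0$; $V$ need not be symmetric). (A5) The matrices $R_n$ are positive semidefinite, $\{R_n\}$ is independent of $\{W_t\}$, and almost surely $R_n\to R$ for a symmetric positive definite matrix $R$. Let $m>q>0$ be integers and $p=1-q/m$. For each $n$ let $\sigma_{1,n},\dots,\sigma_{m-1,n}$ be uniform random permutations of $\{1,\dots,n\}$ and $\pi$ (possibly redrawn for each $n$) a uniform random permutation of $\{0,\dots,m-1\}$, mutually independent and independent of the data $(\{\varphi_t\},\{\psi_t\},\{W_t\},\{R_n\})$. For $\theta\in\mathbb{R}^d$ put $\varepsilon_t(\theta)=Y_t-\varphi_t^{\mathrm T}\theta$, $$S_0(\theta)=R_n^{-1/2}\frac1n\sum_{t=1}^n\psi_t\varepsilon_t(\theta),\qquad S_i(\theta)=R_n^{-1/2}\frac1n\sum_{t=1}^n\psi_t\varepsilon_{\sigma_{i,n}(t)}(\theta)\quad(1\le i\le m-1),$$ where $R_n^{-1/2}$ is the inverse of the principal square root of $R_n$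 (almost surely defined for all large $n$; any convention, e.g. the zero matrix, may be used when $R_n$ is singular), and let $\mathcal{R}(\theta)=1+\#\{1\le i\le m-1:\ \|S_0(\theta)\|^2\succ_\pi\|S_i(\theta)\|^2\}$, where $\|S_0(\theta)\|^2\succ_\pi\|S_i(\theta)\|^2$ means that $\|S_0(\theta)\|^2>\|S_i(\theta)\|^2$, or that the two are equal and $\pi(0)>\pi(i)$. The Residual-Permuted Sums (RPS) confidence region is $\Theta_{p,n}=\{\theta\in\mathbb{R}^d:\mathcal{R}(\theta)\le m-q\}$. Then the regions are uniformly strongly consistent: for every $\varepsilon>0$, almost surely there is a $k$ such that $\Theta_{p,n}\subseteq\{\theta\in\mathbb{R}^d:\|\theta-\theta^*\|\le\varepsilon\}$ for all $n\ge k$; that is, $$\mathbb{P}\Big(\bigcup_{k=1}^\infty\bigcap_{n=k}^\infty\{\Theta_{p,n}\subseteq\mathcal{B}_\varepsilon(\theta^*)\}\Big)=1,\qquad \mathcal{B}_\varepsilon(\theta^*)=\{\theta:\|\theta-\theta^*\|\le\varepsilon\}.$$ -/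

import Mathlib

open MeasureTheory ProbabilityTheory Filter Topology
open scoped NNReal ENNReal

noncomputable section

namespace RPS

/-- `ℝ^d` with its Euclidean norm. -/
abbrev Vec (d : ℕ) := EuclideanSpace ℝ (Fin d)

/-- Real `d × d` matrices. -/
abbrev Mat (d : ℕ) := Matrix (Fin d) (Fin d) ℝ

/-- The indices `1, …, m - 1` of the perturbed sums; the index `0` is the reference sum. -/
abbrev PertIdx (m : ℕ) [NeZero m] := {i : Fin m // i ≠ 0}

/-- Permutations of a finite set carry the discrete σ-algebra. -/
instance permMeasurableSpace (n : ℕ) : MeasurableSpace (Equiv.Perm (Fin n)) := ⊤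

/-! ### The algorithm, for one realisation of a sample of size `n`

The sample indices `1, …, n` are represented by `Fin n`, that is, by `0, …, n - 1`. -/

section Algorithm

variable {d n : ℕ}

/-- The prediction error `ε_t(θ) = Y_t - φ_tᵀ θ`. -/
def predErr (φ : Fin n → Vec d) (Y : Fin n → ℝ) (θ : Vec d) (t : Fin n) : ℝ :=
  Y t - inner ℝ (φ t) θ

open scoped MatrixOrder in
/-- `R^{-1/2}`, the inverse of the principal (positive semidefinite) square root of `R`. -/
def invSqrt (R : Mat d) : Mat d := (CFC.sqrt R)⁻¹

/-- The reference sum `S_0(θ) = R_n^{-1/2} (1/n) ∑_t ψ_t ε_t(θ)`. -/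
def refSum (φ ψ : Fin n → Vec d) (Y : Fin n → ℝ) (R : Mat d) (θ : Vec d) : Vec d :=
  Matrix.toEuclideanCLM (𝕜 := ℝ) (invSqrt R)
    ((n : ℝ)⁻¹ • ∑ t : Fin n, predErr φ Y θ t • ψ t)

/-- The residual-permuted sum `R_n^{-1/2} (1/n) ∑_t ψ_t ε_{τ(t)}(θ)` for a permutation `τ`;
`S_i(θ)` is the case `τ = σ_{i,n}`. -/
def permSum (φ ψ : Fin n → Vec d) (Y : Fin n → ℝ) (R : Mat d) (τ : Equiv.Perm (Fin n))
    (θ : Vec d) : Vec d :=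
  Matrix.toEuclideanCLM (𝕜 := ℝ) (invSqrt R)
    ((n : ℝ)⁻¹ • ∑ t : Fin n, predErr φ Y θ (τ t) • ψ t)

/-- `a ≻_π b` for the values `a`, `b` carried by the indices `k`, `j`: the order `>` with ties
broken by the permutation `π`. -/
def TieGT {m : ℕ} (π : Equiv.Perm (Fin m)) (k j : Fin m) (a b : ℝ) : Prop :=
  a > b ∨ (a = b ∧ π k > π j)

open Classical in
/-- The rank `1 + ∑_{i=1}^{m-1} 𝕀(‖S_0(θ)‖² ≻_π ‖S_i(θ)‖²)`. -/
def rank {m : ℕ} [NeZero m] (φ ψ : Fin n → Vec d) (Y : Fin n → ℝ) (R : Mat d)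
    (σ : PertIdx m → Equiv.Perm (Fin n)) (π : Equiv.Perm (Fin m)) (θ : Vec d) : ℕ :=
  1 + ∑ i : PertIdx m,
    if TieGT π 0 i (‖refSum φ ψ Y R θ‖ ^ 2) (‖permSum φ ψ Y R (σ i) θ‖ ^ 2) then 1 else 0

/-- The confidence region: all `θ` whose rank is at most `m - q`. Its level is `1 - q / m`. -/
def confRegion {m : ℕ} [NeZero m] (q : ℕ) (φ ψ : Fin n → Vec d) (Y : Fin n → ℝ) (R : Mat d)
    (σ : PertIdx m → Equiv.Perm (Fin n)) (π : Equiv.Perm (Fin m)) : Set (Vec d) :=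
  {θ | rank φ ψ Y R σ π θ ≤ m - q}

end Algorithm

/-! ### The assumptions

Sequences are indexed by `ℕ`; the sample of size `n` consists of the first `n` terms. -/

section Assumptions

variable {Ω : Type*} [MeasurableSpace Ω] {d : ℕ}

/-- `ℓ`-independence: every `X_t` is independent of the whole family `{X_k}_{|t - k| ≥ ℓ}`. -/
def LIndep {β : Type*} [MeasurableSpace β] (ℓ : ℕ) (X : ℕ → Ω → β) (μ : Measure Ω) : Prop :=
  ∀ t : ℕ, IndepFun (X t)
    (fun ω (k : {k : ℕ // (ℓ : ℤ) ≤ |(t : ℤ) - (k : ℤ)|}) => X k ω) μ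

/-- The noise is i.i.d. with a finite fourth moment. -/
structure NoiseAssumption (W : ℕ → Ω → ℝ) (μ : Measure Ω) : Prop where
  measurable : ∀ t, Measurable (W t)
  indep : iIndepFun W μ
  identDistrib : ∀ t, IdentDistrib (W t) (W 0) μ μ
  fourth_moment : ∫⁻ ω, ‖W 0 ω‖ₑ ^ 4 ∂μ < ∞

/-- The regressors are `ℓ`-independent with fourth moments bounded by `κ`. -/
structure RegressorAssumption (ℓ : ℕ) (κ : ℝ≥0) (φ : ℕ → Ω → Vec d) (μ : Measure Ω) : Prop where
  measurable : ∀ t, Measurable (φ t)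
  fourth_moment : ∀ t, ∫⁻ ω, ‖φ t ω‖ₑ ^ 4 ∂μ ≤ κ
  lIndep : LIndep ℓ φ μ

/-- The co-regressors are `ℓ`-independent with fourth moments bounded by `κ`, the whole sequence
is independent of the noise sequence, and `E[ψ_t W_t] = 0`. -/
structure CoRegressorNoiseAssumption (ℓ : ℕ) (κ : ℝ≥0) (ψ : ℕ → Ω → Vec d) (W : ℕ → Ω → ℝ)
    (μ : Measure Ω) : Prop where
  measurable : ∀ t, Measurable (ψ t)
  lIndep : LIndep ℓ ψ μ
  fourth_moment : ∀ t, ∫⁻ ω, ‖ψ t ω‖ₑ ^ 4 ∂μ ≤ κ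
  indep_noise : IndepFun (fun ω t => ψ t ω) (fun ω t => W t ω) μ
  uncorrelated : ∀ t, ∫ ω, W t ω • ψ t ω ∂μ = 0

/-- `V_n = (1/n) ∑_{t ≤ n} ψ_t φ_tᵀ`. -/
def covMat (φ ψ : ℕ → Ω → Vec d) (n : ℕ) (ω : Ω) : Mat d :=
  Matrix.of fun k l => (n : ℝ)⁻¹ * ∑ t ∈ Finset.range n, ψ t ω k * φ t ω l

/-- Co-regressors and regressors: independence and `E[ψ_i φ_jᵀ] = 0` at distance at least `ℓ`,
bounded fourth cross moments at distance less than `ℓ`, and `V_n → V` almost surely. The limit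
`V` is positive definite in the sense `xᵀ V x > 0` for `x ≠ 0`; as `ψ_t φ_tᵀ` need not be a
symmetric matrix, `V` is not required to be symmetric. -/
structure CoRegressorRegressorAssumption (ℓ : ℕ) (κ : ℝ≥0) (φ ψ : ℕ → Ω → Vec d) (V : Mat d)
    (μ : Measure Ω) : Prop where
  indep : ∀ i j : ℕ, (ℓ : ℤ) ≤ |(i : ℤ) - (j : ℤ)| → IndepFun (ψ i) (φ j) μ
  uncorrelated : ∀ i j : ℕ, (ℓ : ℤ) ≤ |(i : ℤ) - (j : ℤ)| →
    ∀ k l : Fin d, ∫ ω, ψ i ω k * φ j ω l ∂μ = 0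
  cross_moment : ∀ k l : Fin d, ∀ i j : ℕ, |(i : ℤ) - (j : ℤ)| < (ℓ : ℤ) →
    ∫⁻ ω, ‖ψ i ω k‖ₑ ^ 4 * ‖φ j ω l‖ₑ ^ 4 ∂μ ≤ κ
  limit_pos : ∀ x : Fin d → ℝ, x ≠ 0 → 0 < x ⬝ᵥ V.mulVec x
  tendsto : ∀ᵐ ω ∂μ, Tendsto (fun n => covMat φ ψ n ω) atTop (𝓝 V)

/-- The shaping matrices `R_n` are random, positive semidefinite, jointly independent of the
noise sequence, and converge almost surely to the positive definite matrix `Rlim`. -/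
structure ShapingAssumption (R : ℕ → Ω → Mat d) (Rlim : Mat d) (W : ℕ → Ω → ℝ)
    (μ : Measure Ω) : Prop where
  measurable : ∀ n k l, Measurable (fun ω => R n ω k l)
  indep_noise : IndepFun (fun ω n k l => R n ω k l) (fun ω t => W t ω) μ
  posSemidef : ∀ n, ∀ᵐ ω ∂μ, (R n ω).PosSemidef
  limit_posDef : Rlim.PosDef
  tendsto : ∀ᵐ ω ∂μ, Tendsto (fun n => R n ω) atTop (𝓝 Rlim)

/-- The random choices of the algorithm: for every sample size `n`, the permutations
`σ_{1,n}, …, σ_{m-1,n}` of the sample and the tie-breaking permutation `π` of `{0, …, m - 1}` are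
uniform, mutually independent and independent of the data. Nothing is required of their joint law
for different `n`. -/
structure RandomizationAssumption {m : ℕ} [NeZero m] (φ ψ : ℕ → Ω → Vec d) (W : ℕ → Ω → ℝ)
    (R : ℕ → Ω → Mat d) (σ : (n : ℕ) → PertIdx m → Ω → Equiv.Perm (Fin n))
    (π : ℕ → Ω → Equiv.Perm (Fin m)) (μ : Measure Ω) : Prop where
  measurable_perm : ∀ n i, Measurable (σ n i)
  measurable_tie : ∀ n, Measurable (π n)
  uniform_perm : ∀ n i (τ : Equiv.Perm (Fin n)),
    μ {ω | σ n i ω = τ} = ((n.factorial : ℕ) : ℝ≥0∞)⁻¹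
  uniform_tie : ∀ n (τ : Equiv.Perm (Fin m)), μ {ω | π n ω = τ} = ((m.factorial : ℕ) : ℝ≥0∞)⁻¹
  indep_perm : ∀ n, iIndepFun (σ n) μ
  indep_perm_tie : ∀ n, IndepFun (fun ω i => σ n i ω) (π n) μ
  indep_data : ∀ n, IndepFun
    (fun ω => ((fun t => φ t ω), (fun t => ψ t ω), (fun t => W t ω), (fun k i j => R k ω i j)))
    (fun ω => ((fun i => σ n i ω), π n ω)) μ

/-- The (random) confidence region `Θ_{p,n}` computed from the first `n` data points. -/
def region {m : ℕ} [NeZero m] (q : ℕ) (φ ψ : ℕ → Ω → Vec d) (Y : ℕ → Ω → ℝ)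
    (R : ℕ → Ω → Mat d) (σ : (n : ℕ) → PertIdx m → Ω → Equiv.Perm (Fin n))
    (π : ℕ → Ω → Equiv.Perm (Fin m)) (n : ℕ) (ω : Ω) : Set (Vec d) :=
  confRegion q (fun t : Fin n => φ t ω) (fun t : Fin n => ψ t ω) (fun t : Fin n => Y t ω)
    (R n ω) (fun i => σ n i ω) (π n ω)

end Assumptions

end RPS

end

/-!
Write `v = θ* - θ`. The reference sum is `S_0(θ) = R_n^{-1/2} (V_n v + w_n)` with
`V_n = (1/n) ∑ ψ_t φ_tᵀ` and `w_n = (1/n) ∑ ψ_t W_t`, and a permuted sum is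
`R_n^{-1/2} (A_n v + u_n)` with `A_n = (1/n) ∑ ψ_t φ_{σ(t)}ᵀ` and `u_n = (1/n) ∑ ψ_t W_{σ(t)}`. Almost
surely `V_n → V`, while `w_n`, `A_n` and `u_n` tend to zero. As `‖V v‖ ≥ c ‖v‖` for some `c > 0` and
the norms `‖R_n^{-1/2} x‖` are eventually equivalent to `‖x‖`, the reference sum then dominates all
permuted sums simultaneously for all `θ` with `‖v‖ > ε`. Such `θ` have rank `m > m - q` and are not
in the region (`eventually_confRegion_subset`).

The convergence `w_n → 0` is a strong law for sequences that are uncorrelated at distance at least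
`ℓ` and have bounded second moments (`ae_tendsto_average_zero`).

For `A_n` and `u_n`, nothing is known about the joint law of `(φ_t)` and `(ψ_t)` beyond pairs, so
the randomness of the permutation has to do the work. Conditionally on the data, the permuted
average `(1/n) ∑ a_t b_{τ(t)}` has mean `ā b̄`, the product of the averages, and its centred fourth
moment is at most `48 (∑ a_t⁴) (∑ b_t⁴) / n⁴` (`sum_centredPermSum_pow_four_le`, an
exchangeable-pairs argument with random transpositions). Bounded fourth moments give
`∑_{t ≤ n} a_t⁴ = O(n^{5/4})` almost surely, so that the conditional fourth moments are summable,
and a conditional Borel-Cantelli argument (`ae_tsum_lt_top_of_indepFun`) yields almost sure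
convergence to zero of the difference, whatever the joint law of the permutations for different `n`
(`ae_tendsto_permuted_average`). Finally `ā b̄ → 0`: by the strong law the averages may be replaced
by the averages of the means, and the products of the means of `ψ_i` and `φ_j` vanish for
`|i - j| ≥ ℓ`, those of `ψ_i` and `W_j` always.
-/

namespace RPS

/-! ### Fourth moment of a permuted sum -/

section PermutationMoment

variable {n : ℕ}

/-- The permuted sum `∑ a_t b_{τ(t)}`, centred by its average `(∑ a) (∑ b) / n` over all
permutations `τ`. -/
noncomputable def centredPermSum (a b : Fin n → ℝ) (τ : Equiv.Perm (Fin n)) : ℝ :=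
  ∑ t, a t * b (τ t) - (n : ℝ)⁻¹ * ((∑ t, a t) * ∑ t, b t)

/-- The change of the permuted sum when `τ` is composed with the transposition of `i` and `j`. -/
def swapDiff (a b : Fin n → ℝ) (τ : Equiv.Perm (Fin n)) (i j : Fin n) : ℝ :=
  (a i - a j) * (b (τ i) - b (τ j))

lemma centredPermSum_mul_swap (a b : Fin n → ℝ) (τ : Equiv.Perm (Fin n)) (i j : Fin n) :
    centredPermSum a b (τ * Equiv.swap i j) = centredPermSum a b τ - swapDiff a b τ i j := by
  have key : ∑ t, (a t * b ((τ * Equiv.swap i j) t) - a t * b (τ t)) = - swapDiff a b τ i j := by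
    rcases eq_or_ne i j with rfl | hij
    · simp [swapDiff]
    · rw [Finset.sum_eq_add i j hij]
      · simp [swapDiff]; ring
      · rintro t - ⟨h1, h2⟩
        simp [Equiv.swap_apply_of_ne_of_ne h1 h2]
      · simp
      · simp
  rw [Finset.sum_sub_distrib] at key
  unfold centredPermSum
  linarith

lemma swapDiff_mul_swap (a b : Fin n → ℝ) (τ : Equiv.Perm (Fin n)) (i j : Fin n) :
    swapDiff a b (τ * Equiv.swap i j) i j = - swapDiff a b τ i j := by
  simp [swapDiff]
  ring

lemma sum_mul_swap (i j : Fin n) (g : Equiv.Perm (Fin n) → ℝ) :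
    ∑ τ, g (τ * Equiv.swap i j) = ∑ τ, g τ :=
  Equiv.sum_comp (Equiv.mulRight (Equiv.swap i j)) g

lemma sum_swapDiff (a b : Fin n → ℝ) (τ : Equiv.Perm (Fin n)) :
    ∑ i, ∑ j, swapDiff a b τ i j = 2 * n * centredPermSum a b τ := by
  rcases Nat.eq_zero_or_pos n with rfl | hn
  · simp
  have hb : ∑ t, b (τ t) = ∑ t, b t := Equiv.sum_comp τ b
  have h : ∀ i j, swapDiff a b τ i j
      = a i * b (τ i) - a i * b (τ j) - a j * b (τ i) + a j * b (τ j) := by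
    intro i j; unfold swapDiff; ring
  have hn2 : ∑ t, a t * (n * b (τ t)) = n * ∑ t, a t * b (τ t) := by
    rw [Finset.mul_sum]; exact Finset.sum_congr rfl fun t _ => by ring
  simp only [h, Finset.sum_add_distrib, Finset.sum_sub_distrib, ← Finset.mul_sum,
    ← Finset.sum_mul, Finset.sum_const, Finset.card_univ, Fintype.card_fin, nsmul_eq_mul, hb,
    centredPermSum, hn2]
  field_simp
  ring

lemma sum_sum_sub_pow_four_le (a : Fin n → ℝ) :
    ∑ i, ∑ j, (a i - a j) ^ 4 ≤ 16 * n * ∑ t, a t ^ 4 := by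
  have h : ∀ i j, (a i - a j) ^ 4 ≤ 8 * (a i ^ 4 + a j ^ 4) := by
    intro i j
    nlinarith [sq_nonneg (a i + a j), sq_nonneg (a i ^ 2 - a j ^ 2), sq_nonneg (a i - a j),
      mul_nonneg (sq_nonneg (a i + a j)) (sq_nonneg (a i + a j)),
      mul_nonneg (sq_nonneg (a i + a j)) (sq_nonneg (a i - a j))]
  calc ∑ i, ∑ j, (a i - a j) ^ 4 ≤ ∑ i, ∑ j, 8 * (a i ^ 4 + a j ^ 4) := by
        gcongr with i _ j _; exact h i j
    _ = 16 * n * ∑ t, a t ^ 4 := by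
        simp only [← Finset.mul_sum, Finset.sum_add_distrib, Finset.sum_const, Finset.card_univ,
          Fintype.card_fin, nsmul_eq_mul]
        ring

/-- By the Cauchy-Schwarz inequality, the sum of all squared changes has a bound that does not
depend on the permutation. -/
lemma sum_swapDiff_sq_le (a b : Fin n → ℝ) (τ : Equiv.Perm (Fin n)) :
    ∑ i, ∑ j, swapDiff a b τ i j ^ 2
      ≤ 16 * n * √((∑ t, a t ^ 4) * ∑ t, b t ^ 4) := by
  have hcs := Finset.sum_mul_sq_le_sq_mul_sq (Finset.univ : Finset (Fin n × Fin n))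
    (fun x => (a x.1 - a x.2) ^ 2) (fun x => (b (τ x.1) - b (τ x.2)) ^ 2)
  simp only [Fintype.sum_prod_type, ← pow_mul] at hcs
  have ha := sum_sum_sub_pow_four_le a
  have hb := sum_sum_sub_pow_four_le (fun t => b (τ t))
  rw [Equiv.sum_comp τ (fun t => b t ^ 4)] at hb
  have h0a : 0 ≤ ∑ t, a t ^ 4 := Finset.sum_nonneg fun i _ => by positivity
  have h0b : 0 ≤ ∑ t, b t ^ 4 := Finset.sum_nonneg fun i _ => by positivity
  simp only [swapDiff, mul_pow]
  refine (Real.le_sqrt_of_sq_le (y := (16 * n * ∑ t, a t ^ 4) * (16 * n * ∑ t, b t ^ 4))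
    ?_).trans_eq ?_
  · refine hcs.trans (mul_le_mul ha hb ?_ (mul_nonneg (by positivity) h0a))
    exact Finset.sum_nonneg fun i _ => Finset.sum_nonneg fun j _ =>
      Even.pow_nonneg (by decide) _
  · rw [show (16 * n * ∑ t, a t ^ 4) * (16 * n * ∑ t, b t ^ 4)
      = (16 * n : ℝ) ^ 2 * ((∑ t, a t ^ 4) * ∑ t, b t ^ 4) by ring,
      Real.sqrt_mul (by positivity), Real.sqrt_sq (by positivity)]

lemma two_mul_sum_mul_swapDiff (a b : Fin n → ℝ) (i j : Fin n) :
    2 * ∑ τ, centredPermSum a b τ * swapDiff a b τ i j = ∑ τ, swapDiff a b τ i j ^ 2 := by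
  have h := sum_mul_swap i j (fun τ => centredPermSum a b τ * swapDiff a b τ i j)
  simp only [centredPermSum_mul_swap, swapDiff_mul_swap] at h
  rw [two_mul]
  nth_rewrite 1 [← h]
  rw [← Finset.sum_add_distrib]
  exact Finset.sum_congr rfl fun τ _ => by ring

/-- Replacing `τ` by its composition with a transposition changes `f` to `f - D` and flips the sign
of the difference `D`, so that the left side equals the sum of `D (f³ - (f - D)³)`. -/
lemma two_mul_sum_pow_three_mul_swapDiff_le (a b : Fin n → ℝ) (i j : Fin n) :
    2 * ∑ τ, centredPermSum a b τ ^ 3 * swapDiff a b τ i j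
      ≤ 3 * ∑ τ, centredPermSum a b τ ^ 2 * swapDiff a b τ i j ^ 2 := by
  have h := sum_mul_swap i j (fun τ => centredPermSum a b τ ^ 3 * swapDiff a b τ i j)
  have h2 := sum_mul_swap i j (fun τ => centredPermSum a b τ ^ 2 * swapDiff a b τ i j ^ 2)
  simp only [centredPermSum_mul_swap, swapDiff_mul_swap] at h h2
  have h3 : 2 * ∑ τ, centredPermSum a b τ ^ 3 * swapDiff a b τ i j
      ≤ ∑ τ, (3 / 2 * (centredPermSum a b τ ^ 2 * swapDiff a b τ i j ^ 2)
        + 3 / 2 * ((centredPermSum a b τ - swapDiff a b τ i j) ^ 2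
          * (-swapDiff a b τ i j) ^ 2)) := by
    rw [two_mul]
    nth_rewrite 1 [← h]
    rw [← Finset.sum_add_distrib]
    refine Finset.sum_le_sum fun τ _ => ?_
    generalize centredPermSum a b τ = f
    generalize swapDiff a b τ i j = D
    nlinarith [mul_nonneg (sq_nonneg D) (sq_nonneg D)]
  rw [Finset.sum_add_distrib, ← Finset.mul_sum, ← Finset.mul_sum, h2] at h3
  linarith

/-- The fourth moment of a centred permuted sum under the uniform distribution on permutations,
by the method of exchangeable pairs: summing `swapDiff` over all transpositions recovers the
centred sum, which turns the fourth moment into a bound by the second moment, and the second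
moment into a constant. -/
theorem sum_centredPermSum_pow_four_le (a b : Fin n → ℝ) :
    ∑ τ, centredPermSum a b τ ^ 4
      ≤ 48 * (n.factorial : ℝ) * ((∑ t, a t ^ 4) * ∑ t, b t ^ 4) := by
  have h0a : 0 ≤ ∑ t, a t ^ 4 := Finset.sum_nonneg fun i _ => by positivity
  have h0b : 0 ≤ ∑ t, b t ^ 4 := Finset.sum_nonneg fun i _ => by positivity
  rcases Nat.eq_zero_or_pos n with rfl | hn
  · simp [centredPermSum]
  have hn' : (0 : ℝ) < n := by exact_mod_cast hn
  set s := √((∑ t, a t ^ 4) * ∑ t, b t ^ 4) with hs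
  have hs2 : s ^ 2 = (∑ t, a t ^ 4) * ∑ t, b t ^ 4 := Real.sq_sqrt (by positivity)
  have hs0 : 0 ≤ s := Real.sqrt_nonneg _
  have hcard : ∑ _τ : Equiv.Perm (Fin n), (16 * n * s) = (n.factorial : ℝ) * (16 * n * s) := by
    simp [Fintype.card_perm]
  have hpull : ∀ g : Equiv.Perm (Fin n) → ℝ, ∑ τ, g τ * (2 * n * centredPermSum a b τ)
      = ∑ i, ∑ j, ∑ τ, g τ * swapDiff a b τ i j := by
    intro g
    simp only [← sum_swapDiff, Finset.mul_sum]
    rw [Finset.sum_comm]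
    exact Finset.sum_congr rfl fun i _ => Finset.sum_comm
  have hpull2 : ∀ g : Equiv.Perm (Fin n) → ℝ, ∑ i, ∑ j, ∑ τ, g τ * swapDiff a b τ i j ^ 2
      = ∑ τ, g τ * ∑ i, ∑ j, swapDiff a b τ i j ^ 2 := by
    intro g
    simp only [Finset.mul_sum]
    rw [eq_comm, Finset.sum_comm]
    exact Finset.sum_congr rfl fun i _ => Finset.sum_comm
  have h2 : 4 * n * ∑ τ, centredPermSum a b τ ^ 2 ≤ n.factorial * (16 * n * s) := by
    have h1 := hpull (fun τ => centredPermSum a b τ)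
    have h3 : 2 * ∑ τ, centredPermSum a b τ * (2 * n * centredPermSum a b τ)
        = ∑ τ, 1 * ∑ i, ∑ j, swapDiff a b τ i j ^ 2 := by
      rw [h1, ← hpull2]
      simp only [Finset.mul_sum, one_mul, ← two_mul_sum_mul_swapDiff]
    have h4 : 4 * n * ∑ τ, centredPermSum a b τ ^ 2
        = 2 * ∑ τ, centredPermSum a b τ * (2 * n * centredPermSum a b τ) := by
      simp only [Finset.mul_sum]
      exact Finset.sum_congr rfl fun τ _ => by ring
    rw [h4, h3, ← hcard]
    refine Finset.sum_le_sum fun τ _ => ?_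
    rw [one_mul]
    exact sum_swapDiff_sq_le a b τ
  have h4 : 4 * n * ∑ τ, centredPermSum a b τ ^ 4
      ≤ 3 * (16 * n * s) * ∑ τ, centredPermSum a b τ ^ 2 := by
    have h1 := hpull (fun τ => centredPermSum a b τ ^ 3)
    have h5 : 4 * n * ∑ τ, centredPermSum a b τ ^ 4
        = 2 * ∑ τ, centredPermSum a b τ ^ 3 * (2 * n * centredPermSum a b τ) := by
      simp only [Finset.mul_sum]
      exact Finset.sum_congr rfl fun τ _ => by ring
    calc 4 * n * ∑ τ, centredPermSum a b τ ^ 4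
        = ∑ i, ∑ j, 2 * ∑ τ, centredPermSum a b τ ^ 3 * swapDiff a b τ i j := by
          rw [h5, h1]; simp only [Finset.mul_sum]
      _ ≤ ∑ i, ∑ j, 3 * ∑ τ, centredPermSum a b τ ^ 2 * swapDiff a b τ i j ^ 2 := by
          refine Finset.sum_le_sum fun i _ => Finset.sum_le_sum fun j _ => ?_
          exact two_mul_sum_pow_three_mul_swapDiff_le a b i j
      _ = 3 * ∑ τ, centredPermSum a b τ ^ 2 * ∑ i, ∑ j, swapDiff a b τ i j ^ 2 := by
          simp only [← Finset.mul_sum]; rw [hpull2]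
      _ ≤ 3 * ∑ τ, centredPermSum a b τ ^ 2 * (16 * n * s) := by
          gcongr with τ _
          exact sum_swapDiff_sq_le a b τ
      _ = _ := by rw [← Finset.sum_mul]; ring
  have h2' : ∑ τ, centredPermSum a b τ ^ 2 ≤ n.factorial * (4 * s) := by
    have : (4 * n : ℝ) * ∑ τ, centredPermSum a b τ ^ 2 ≤ 4 * n * (n.factorial * (4 * s)) := by
      linarith
    exact le_of_mul_le_mul_left this (by positivity)
  have h4' : ∑ τ, centredPermSum a b τ ^ 4 ≤ 12 * s * ∑ τ, centredPermSum a b τ ^ 2 := by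
    have : (4 * n : ℝ) * ∑ τ, centredPermSum a b τ ^ 4
      ≤ 4 * n * (12 * s * ∑ τ, centredPermSum a b τ ^ 2) := by linarith
    exact le_of_mul_le_mul_left this (by positivity)
  calc ∑ τ, centredPermSum a b τ ^ 4 ≤ 12 * s * (n.factorial * (4 * s)) :=
        h4'.trans (by gcongr)
    _ = 48 * (n.factorial : ℝ) * s ^ 2 := by ring
    _ = _ := by rw [hs2]

end PermutationMoment

/-! ### A strong law for weakly correlated sequences -/

section StrongLaw

variable {Ω : Type*} [MeasurableSpace Ω] {μ : Measure Ω}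

lemma tendsto_zero_of_tsum_ofReal_sq {z : ℕ → ℝ} {r : ℕ} (hr : r ≠ 0)
    (h : ∑' k, ENNReal.ofReal (|z k| ^ r) ≠ ∞) : Tendsto z atTop (𝓝 0) := by
  have h1 := ENNReal.tendsto_atTop_zero_of_tsum_ne_top h
  have h2 := (ENNReal.tendsto_toReal ENNReal.zero_ne_top).comp h1
  have h3 : Tendsto (fun k => |z k| ^ r) atTop (𝓝 0) := by
    refine h2.congr fun k => ?_
    simp only [Function.comp_apply]
    rw [ENNReal.toReal_ofReal (by positivity)]
  have h4 := h3.rpow_const (p := (r : ℝ)⁻¹) (Or.inr (by positivity))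
  rw [Real.zero_rpow (by positivity)] at h4
  rw [tendsto_zero_iff_abs_tendsto_zero]
  refine h4.congr fun k => ?_
  simp only [Function.comp_apply]
  rw [Real.pow_rpow_inv_natCast (abs_nonneg _) hr]

lemma ae_tendsto_zero_of_summable_integral_sq {Z : ℕ → Ω → ℝ} {c : ℕ → ℝ}
    (hZ : ∀ k, Integrable (fun ω => Z k ω ^ 2) μ) (hc : ∀ k, ∫ ω, Z k ω ^ 2 ∂μ ≤ c k)
    (hs : Summable c) : ∀ᵐ ω ∂μ, Tendsto (fun k => Z k ω) atTop (𝓝 0) := by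
  have hfin : ∫⁻ ω, ∑' k, ENNReal.ofReal (Z k ω ^ 2) ∂μ ≠ ∞ := by
    rw [lintegral_tsum fun k => (hZ k).aemeasurable.ennreal_ofReal]
    have h1 : ∀ k, ∫⁻ ω, ENNReal.ofReal (Z k ω ^ 2) ∂μ ≤ ENNReal.ofReal (c k) := by
      intro k
      rw [← ofReal_integral_eq_lintegral_ofReal (hZ k) (ae_of_all _ fun ω => sq_nonneg _)]
      exact ENNReal.ofReal_le_ofReal (hc k)
    exact ne_top_of_le_ne_top hs.tsum_ofReal_ne_top (ENNReal.tsum_le_tsum h1)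
  filter_upwards [ae_lt_top' (AEMeasurable.tsum
    fun k => (hZ k).aemeasurable.ennreal_ofReal) hfin] with ω hω
  refine tendsto_zero_of_tsum_ofReal_sq two_ne_zero ?_
  simpa only [sq_abs] using hω.ne

/-- Second moment of a sum whose terms are uncorrelated at distance at least `ℓ`: only the
`O(ℓ n)` pairs at smaller distance contribute. -/
lemma integral_sum_sq_le {X : ℕ → Ω → ℝ} {C : ℝ} {ℓ : ℕ} (hX : ∀ t, MemLp (X t) 2 μ)
    (hC : ∀ t, ∫ ω, X t ω ^ 2 ∂μ ≤ C)
    (hcov : ∀ s t : ℕ, (ℓ : ℤ) ≤ |(s : ℤ) - t| → ∫ ω, X s ω * X t ω ∂μ = 0) (n : ℕ) :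
    ∫ ω, (∑ t ∈ Finset.range n, X t ω) ^ 2 ∂μ ≤ 2 * ℓ * C * n := by
  have hint : ∀ s t, Integrable (fun ω => X s ω * X t ω) μ :=
    fun s t => (hX s).integrable_mul (hX t)
  have hsq : ∀ t, Integrable (fun ω => X t ω ^ 2) μ := fun t => (hX t).integrable_sq
  have hC0 : 0 ≤ C := (integral_nonneg fun ω => sq_nonneg (X 0 ω)).trans (hC 0)
  have hst : ∀ s t, ∫ ω, X s ω * X t ω ∂μ ≤ C := by
    intro s t
    have : ∫ ω, X s ω * X t ω ∂μ ≤ ∫ ω, (1 / 2 : ℝ) * (X s ω ^ 2 + X t ω ^ 2) ∂μ := by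
      refine integral_mono (hint s t) (((hsq s).add (hsq t)).const_mul _) fun ω => ?_
      nlinarith [sq_nonneg (X s ω - X t ω)]
    rw [integral_const_mul, integral_add (hsq s) (hsq t)] at this
    linarith [hC s, hC t]
  simp only [sq, Finset.sum_mul_sum]
  rw [integral_finsetSum _ fun s _ => integrable_finsetSum _ fun t _ => hint s t]
  calc ∑ s ∈ Finset.range n, ∫ ω, ∑ t ∈ Finset.range n, X s ω * X t ω ∂μ
      ≤ ∑ s ∈ Finset.range n, 2 * ℓ * C := ?_
    _ = 2 * ℓ * C * n := by simp; ring
  refine Finset.sum_le_sum fun s _ => ?_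
  rw [integral_finsetSum _ fun t _ => hint s t]
  have hsub : (Finset.range n).filter (fun t : ℕ => |(s : ℤ) - t| < ℓ)
      ⊆ Finset.Ico (s + 1 - ℓ) (s + ℓ) := by
    intro t ht
    simp only [Finset.mem_filter, Finset.mem_range, Finset.mem_Ico, abs_lt] at ht ⊢
    omega
  calc ∑ t ∈ Finset.range n, ∫ ω, X s ω * X t ω ∂μ
      ≤ ∑ t ∈ Finset.range n, if |(s : ℤ) - t| < ℓ then C else 0 := by
        refine Finset.sum_le_sum fun t _ => ?_
        split_ifs with h
        · exact hst s t
        · exact (hcov s t (not_lt.mp h)).le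
    _ = ((Finset.range n).filter (fun t : ℕ => |(s : ℤ) - t| < ℓ)).card * C := by
        rw [← Finset.sum_filter]; simp
    _ ≤ 2 * ℓ * C := by
        gcongr
        have := Finset.card_le_card hsub
        rw [Nat.card_Ico] at this
        exact_mod_cast this.trans (by omega)

/-- A strong law of large numbers of Rajchman type: bounded second moments and vanishing
correlation at distance at least `ℓ` suffice. Averages converge along the squares because the
second moments are summable there, and the gaps between consecutive squares are negligible. -/
theorem ae_tendsto_average_zero {X : ℕ → Ω → ℝ} {C : ℝ} {ℓ : ℕ} (hX : ∀ t, MemLp (X t) 2 μ)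
    (hC : ∀ t, ∫ ω, X t ω ^ 2 ∂μ ≤ C)
    (hcov : ∀ s t : ℕ, (ℓ : ℤ) ≤ |(s : ℤ) - t| → ∫ ω, X s ω * X t ω ∂μ = 0) :
    ∀ᵐ ω ∂μ, Tendsto (fun n : ℕ => (n : ℝ)⁻¹ * ∑ t ∈ Finset.range n, X t ω) atTop (𝓝 0) := by
  have hC0 : 0 ≤ C := (integral_nonneg fun ω => sq_nonneg (X 0 ω)).trans (hC 0)
  have hsq : ∀ t, Integrable (fun ω => X t ω ^ 2) μ := fun t => (hX t).integrable_sq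
  have hsumm : ∀ K : ℝ, Summable fun k : ℕ => K * ((k : ℝ) ^ 2)⁻¹ := fun K =>
    (Real.summable_nat_pow_inv.mpr one_lt_two).mul_left K
  -- the averages along the squares
  have h1 : ∀ᵐ ω ∂μ, Tendsto
      (fun k : ℕ => ((k : ℝ) ^ 2)⁻¹ * ∑ t ∈ Finset.range (k ^ 2), X t ω) atTop (𝓝 0) := by
    refine ae_tendsto_zero_of_summable_integral_sq
      (c := fun k : ℕ => (2 * ℓ * C) * ((k : ℝ) ^ 2)⁻¹) ?_ ?_ (hsumm _)
    · intro k
      simp only [mul_pow]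
      exact (memLp_finsetSum (Finset.range (k ^ 2)) fun t _ => hX t).integrable_sq.const_mul _
    · intro k
      simp only [mul_pow]
      rw [integral_const_mul]
      rcases Nat.eq_zero_or_pos k with rfl | hk
      · simp
      have hk' : (0 : ℝ) < k := by exact_mod_cast hk
      have := integral_sum_sq_le hX hC hcov (k ^ 2)
      push_cast at this
      calc (((k : ℝ) ^ 2)⁻¹) ^ 2 * ∫ ω, (∑ t ∈ Finset.range (k ^ 2), X t ω) ^ 2 ∂μ
          ≤ (((k : ℝ) ^ 2)⁻¹) ^ 2 * (2 * ℓ * C * k ^ 2) := by gcongr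
        _ = _ := by field_simp
  -- the gaps between consecutive squares
  have h2 : ∀ᵐ ω ∂μ, Tendsto (fun k : ℕ => ((k : ℝ) ^ 2)⁻¹ *
      ∑ t ∈ Finset.Ico (k ^ 2) ((k + 1) ^ 2), |X t ω|) atTop (𝓝 0) := by
    refine ae_tendsto_zero_of_summable_integral_sq
      (c := fun k : ℕ => (9 * C) * ((k : ℝ) ^ 2)⁻¹) ?_ ?_ (hsumm _)
    · intro k
      simp only [mul_pow]
      exact (memLp_finsetSum (Finset.Ico (k ^ 2) ((k + 1) ^ 2))
        fun t _ => (hX t).abs).integrable_sq.const_mul _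
    · intro k
      simp only [mul_pow]
      rw [integral_const_mul]
      rcases Nat.eq_zero_or_pos k with rfl | hk
      · simp
      have hk' : (1 : ℝ) ≤ k := by exact_mod_cast hk
      have hcard : (Finset.Ico (k ^ 2) ((k + 1) ^ 2)).card = 2 * k + 1 := by
        rw [Nat.card_Ico]
        have : (k + 1) ^ 2 = k ^ 2 + (2 * k + 1) := by ring
        omega
      have h3 : ∫ ω, (∑ t ∈ Finset.Ico (k ^ 2) ((k + 1) ^ 2), |X t ω|) ^ 2 ∂μ
          ≤ (2 * k + 1) * ((2 * k + 1) * C) := by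
        calc ∫ ω, (∑ t ∈ Finset.Ico (k ^ 2) ((k + 1) ^ 2), |X t ω|) ^ 2 ∂μ
            ≤ ∫ ω, (2 * k + 1) * ∑ t ∈ Finset.Ico (k ^ 2) ((k + 1) ^ 2), X t ω ^ 2 ∂μ := by
              refine integral_mono (memLp_finsetSum (Finset.Ico (k ^ 2) ((k + 1) ^ 2))
                fun t _ => (hX t).abs).integrable_sq
                ((integrable_finsetSum _ fun t _ => hsq t).const_mul _) fun ω => ?_
              have := sq_sum_le_card_mul_sum_sq (s := Finset.Ico (k ^ 2) ((k + 1) ^ 2))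
                (f := fun t => |X t ω|)
              rw [hcard] at this
              simpa using this
          _ = (2 * k + 1) * ∑ t ∈ Finset.Ico (k ^ 2) ((k + 1) ^ 2), ∫ ω, X t ω ^ 2 ∂μ := by
              rw [integral_const_mul, integral_finsetSum _ fun t _ => hsq t]
          _ ≤ (2 * k + 1) * ∑ t ∈ Finset.Ico (k ^ 2) ((k + 1) ^ 2), C := by
              gcongr with t _; exact hC t
          _ = _ := by rw [Finset.sum_const, hcard]; simp
      calc (((k : ℝ) ^ 2)⁻¹) ^ 2 *
            ∫ ω, (∑ t ∈ Finset.Ico (k ^ 2) ((k + 1) ^ 2), |X t ω|) ^ 2 ∂μ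
          ≤ (((k : ℝ) ^ 2)⁻¹) ^ 2 * ((3 * k) * ((3 * k) * C)) := by
            gcongr
            refine h3.trans ?_
            gcongr <;> linarith
        _ = _ := by field_simp; ring
  filter_upwards [h1, h2] with ω hω1 hω2
  have hsqrt : Tendsto Nat.sqrt atTop atTop := by
    refine tendsto_atTop.mpr fun b => ?_
    filter_upwards [eventually_ge_atTop (b ^ 2)] with n hn
    exact Nat.le_sqrt'.mpr hn
  have h4 := (hω1.abs.add hω2).comp hsqrt
  simp only [abs_zero, add_zero] at h4
  refine squeeze_zero_norm' ?_ h4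
  filter_upwards [eventually_ge_atTop 1] with n hn
  simp only [Function.comp_apply, Real.norm_eq_abs]
  set k := Nat.sqrt n with hk
  have hk1 : 1 ≤ k := Nat.le_sqrt'.mpr (by simpa using hn)
  have hkn : k ^ 2 ≤ n := Nat.sqrt_le' n
  have hnk : n < (k + 1) ^ 2 := Nat.lt_succ_sqrt' n
  have hk0 : (0 : ℝ) < (k : ℝ) ^ 2 := by
    have : (0 : ℝ) < k := by exact_mod_cast hk1
    positivity
  have hinv : (n : ℝ)⁻¹ ≤ ((k : ℝ) ^ 2)⁻¹ := inv_anti₀ hk0 (by exact_mod_cast hkn)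
  have hsplit := Finset.sum_range_add_sum_Ico (fun t => X t ω) hkn
  have htail : |∑ t ∈ Finset.Ico (k ^ 2) n, X t ω|
      ≤ ∑ t ∈ Finset.Ico (k ^ 2) ((k + 1) ^ 2), |X t ω| :=
    (Finset.abs_sum_le_sum_abs _ _).trans (Finset.sum_le_sum_of_subset_of_nonneg
      (Finset.Ico_subset_Ico_right hnk.le) fun _ _ _ => abs_nonneg _)
  rw [abs_mul, abs_mul, abs_of_nonneg (by positivity : (0 : ℝ) ≤ (n : ℝ)⁻¹),
    abs_of_pos (inv_pos.mpr hk0), ← mul_add]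
  refine mul_le_mul hinv ?_ (abs_nonneg _) (inv_pos.mpr hk0).le
  rw [← hsplit]
  exact (abs_add_le _ _).trans (by gcongr)

end StrongLaw

/-! ### Almost sure convergence of permuted averages -/

section PermutedAverage

variable {Ω : Type*} [MeasurableSpace Ω] {μ : Measure Ω}

/-- A conditional Borel-Cantelli argument: if every `τ_n` is independent of the data `D` and the
expectations of `g_n(D, τ_n)` over `τ_n` alone have a finite sum for almost every value of `D`,
then `∑ g_n(D, τ_n)` is finite almost surely. The joint law of the `τ_n` plays no role. -/
theorem ae_tsum_lt_top_of_indepFun [IsProbabilityMeasure μ] {E : Type*}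
    [MeasurableSpace E] {T : ℕ → Type*} [∀ n, MeasurableSpace (T n)] {D : Ω → E} (hD : Measurable D) {τ : ∀ n, Ω → T n}
    (hτ : ∀ n, Measurable (τ n)) (hind : ∀ n, IndepFun D (τ n) μ) {g : ∀ n, E × T n → ℝ≥0∞}
    (hg : ∀ n, Measurable (g n))
    (hfin : ∀ᵐ ω ∂μ, ∑' n, ∫⁻ s, g n (D ω, s) ∂(μ.map (τ n)) < ∞) :
    ∀ᵐ ω ∂μ, ∑' n, g n (D ω, τ n ω) < ∞ := by
  have hprob : ∀ n, IsProbabilityMeasure (μ.map (τ n)) := fun n =>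
    Measure.isProbabilityMeasure_map (hτ n).aemeasurable
  set G : E → ℝ≥0∞ := fun x => ∑' n, ∫⁻ s, g n (x, s) ∂(μ.map (τ n)) with hG
  have hGm : Measurable G := Measurable.tsum fun n => (hg n).lintegral_prod_right'
  -- on the set where the conditional sum is at most `M`, the expected sum is at most `M`
  have hM : ∀ M : ℕ, ∀ᵐ ω ∂μ, G (D ω) ≤ M → ∑' n, g n (D ω, τ n ω) < ∞ := by
    intro M
    set B : Set E := {x | G x ≤ M} with hB
    have hBm : MeasurableSet B := measurableSet_le hGm measurable_const
    have hgB : ∀ n, Measurable ((Prod.fst ⁻¹' B).indicator (g n)) := fun n =>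
      (hg n).indicator (measurable_fst hBm)
    have hpair : ∀ n, Measurable fun ω => (D ω, τ n ω) := fun n => hD.prodMk (hτ n)
    have hcomp : ∀ n, AEMeasurable
        (fun ω => (Prod.fst ⁻¹' B).indicator (g n) (D ω, τ n ω)) μ := fun n =>
      ((hgB n).comp (hpair n)).aemeasurable
    have h1 : ∫⁻ ω, ∑' n, (Prod.fst ⁻¹' B).indicator (g n) (D ω, τ n ω) ∂μ ≤ M := by
      rw [lintegral_tsum hcomp]
      have h2 : ∀ n, ∫⁻ ω, (Prod.fst ⁻¹' B).indicator (g n) (D ω, τ n ω) ∂μ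
          = ∫⁻ x, B.indicator (fun x => ∫⁻ s, g n (x, s) ∂(μ.map (τ n))) x ∂(μ.map D) := by
        intro n
        rw [← lintegral_map (hgB n) (hpair n),
          (indepFun_iff_map_prod_eq_prod_map_map hD.aemeasurable (hτ n).aemeasurable).mp (hind n),
          lintegral_prod _ (hgB n).aemeasurable]
        refine lintegral_congr fun x => ?_
        by_cases hx : x ∈ B <;> simp [Set.indicator, hx]
      simp only [h2]
      rw [← lintegral_tsum fun n =>
        ((hg n).lintegral_prod_right'.indicator hBm).aemeasurable]
      calc ∫⁻ x, ∑' n, B.indicator (fun x => ∫⁻ s, g n (x, s) ∂(μ.map (τ n))) x ∂(μ.map D)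
          ≤ ∫⁻ _, M ∂(μ.map D) := by
            refine lintegral_mono fun x => ?_
            by_cases hx : x ∈ B
            · simpa [Set.indicator, hx] using (show G x ≤ M from hx)
            · simp [Set.indicator, hx]
        _ = M := by
            have := Measure.isProbabilityMeasure_map (μ := μ) hD.aemeasurable
            simp
    filter_upwards [ae_lt_top' (AEMeasurable.tsum hcomp)
      (ne_top_of_le_ne_top (ENNReal.natCast_ne_top M) h1)] with ω hω hωB
    have : D ω ∈ B := hωB
    simpa [Set.indicator, this] using hω
  filter_upwards [ae_all_iff.mpr hM, hfin] with ω h1 h2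
  obtain ⟨M, hMω⟩ := ENNReal.exists_nat_gt (show G (D ω) ≠ ∞ from h2.ne)
  exact h1 M hMω.le

/-- Bounded fourth moments control the growth of the sums of fourth powers, without any
assumption on the dependence. -/
lemma ae_exists_sum_pow_four_le {a : ℕ → Ω → ℝ} {K : ℝ}
    (ha : ∀ t, Integrable (fun ω => a t ω ^ 4) μ) (hK : ∀ t, ∫ ω, a t ω ^ 4 ∂μ ≤ K) :
    ∀ᵐ ω ∂μ, ∃ M : ℝ, 0 ≤ M ∧
      ∀ n : ℕ, ∑ t ∈ Finset.range n, a t ω ^ 4 ≤ M * (n : ℝ) ^ (5 / 4 : ℝ) := by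
  have hpow : ∀ t : ℕ, 0 ≤ (((t + 1 : ℕ) : ℝ) ^ (5 / 4 : ℝ))⁻¹ := fun t => by positivity
  have hsumm : Summable fun t : ℕ => K * (((t + 1 : ℕ) : ℝ) ^ (5 / 4 : ℝ))⁻¹ :=
    ((summable_nat_add_iff 1).mpr (Real.summable_nat_rpow_inv.mpr (by norm_num))).mul_left K
  have hm : ∀ t : ℕ, AEMeasurable
      (fun ω => ENNReal.ofReal (a t ω ^ 4 * (((t + 1 : ℕ) : ℝ) ^ (5 / 4 : ℝ))⁻¹)) μ :=
    fun t => ((ha t).mul_const _).aemeasurable.ennreal_ofReal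
  have hfin : ∫⁻ ω, ∑' t : ℕ,
      ENNReal.ofReal (a t ω ^ 4 * (((t + 1 : ℕ) : ℝ) ^ (5 / 4 : ℝ))⁻¹) ∂μ ≠ ∞ := by
    rw [lintegral_tsum hm]
    refine ne_top_of_le_ne_top hsumm.tsum_ofReal_ne_top (ENNReal.tsum_le_tsum fun t => ?_)
    rw [← ofReal_integral_eq_lintegral_ofReal ((ha t).mul_const _)
      (ae_of_all _ fun ω => mul_nonneg (by positivity) (hpow t)), integral_mul_const]
    exact ENNReal.ofReal_le_ofReal (mul_le_mul_of_nonneg_right (hK t) (hpow t))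
  filter_upwards [ae_lt_top' (AEMeasurable.tsum hm) hfin] with ω hω
  refine ⟨(∑' t : ℕ, ENNReal.ofReal
    (a t ω ^ 4 * (((t + 1 : ℕ) : ℝ) ^ (5 / 4 : ℝ))⁻¹)).toReal, ENNReal.toReal_nonneg,
    fun n => ?_⟩
  have h1 : ∑ t ∈ Finset.range n, a t ω ^ 4 * (((t + 1 : ℕ) : ℝ) ^ (5 / 4 : ℝ))⁻¹
      ≤ (∑' t : ℕ, ENNReal.ofReal
        (a t ω ^ 4 * (((t + 1 : ℕ) : ℝ) ^ (5 / 4 : ℝ))⁻¹)).toReal := by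
    rw [← ENNReal.ofReal_le_iff_le_toReal hω.ne,
      ENNReal.ofReal_sum_of_nonneg fun t _ => mul_nonneg (by positivity) (hpow t)]
    exact ENNReal.sum_le_tsum _
  refine le_trans ?_ (mul_le_mul_of_nonneg_right h1 (by positivity))
  rw [Finset.sum_mul]
  refine Finset.sum_le_sum fun t ht => ?_
  have htn : ((t + 1 : ℕ) : ℝ) ≤ n := by exact_mod_cast Finset.mem_range.mp ht
  have h0 : (0 : ℝ) < ((t + 1 : ℕ) : ℝ) ^ (5 / 4 : ℝ) := by positivity
  have h2 : ((t + 1 : ℕ) : ℝ) ^ (5 / 4 : ℝ) ≤ (n : ℝ) ^ (5 / 4 : ℝ) := by gcongr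
  rw [mul_assoc]
  refine le_mul_of_one_le_right (by positivity) ?_
  rw [inv_mul_eq_div]
  exact (one_le_div h0).mpr h2

/-- Under random uniform permutations that are independent of the two sequences, the permuted
averages `(1/n) ∑ a_t b_{τ_n(t)}` are asymptotically equal to the product of the averages. Given
the data, the fourth moment of the difference is at most `48 (∑ a⁴) (∑ b⁴) / n⁴`, which is
`O(n^{-3/2})` and hence summable. -/
theorem ae_tendsto_permuted_average [IsProbabilityMeasure μ] {a b : ℕ → Ω → ℝ} {K K' : ℝ}
    (ham : ∀ t, Measurable (a t)) (hbm : ∀ t, Measurable (b t))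
    (ha : ∀ t, Integrable (fun ω => a t ω ^ 4) μ) (hK : ∀ t, ∫ ω, a t ω ^ 4 ∂μ ≤ K)
    (hb : ∀ t, Integrable (fun ω => b t ω ^ 4) μ) (hK' : ∀ t, ∫ ω, b t ω ^ 4 ∂μ ≤ K')
    {τ : (n : ℕ) → Ω → Equiv.Perm (Fin n)} (hτ : ∀ n, Measurable (τ n))
    (hunif : ∀ n (s : Equiv.Perm (Fin n)), μ {ω | τ n ω = s} = ((n.factorial : ℕ) : ℝ≥0∞)⁻¹)
    (hind : ∀ n, IndepFun (fun ω => ((fun t => a t ω), (fun t => b t ω))) (τ n) μ) :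
    ∀ᵐ ω ∂μ, Tendsto (fun n : ℕ => (n : ℝ)⁻¹ * ∑ t : Fin n, a t ω * b (τ n ω t) ω
      - ((n : ℝ)⁻¹ * ∑ t ∈ Finset.range n, a t ω) * ((n : ℝ)⁻¹ * ∑ t ∈ Finset.range n, b t ω))
      atTop (𝓝 0) := by
  set g : ∀ n, ((ℕ → ℝ) × (ℕ → ℝ)) × Equiv.Perm (Fin n) → ℝ≥0∞ := fun n x =>
    ENNReal.ofReal (|(n : ℝ)⁻¹ *
      centredPermSum (fun t : Fin n => x.1.1 t) (fun t : Fin n => x.1.2 t) x.2| ^ 4) with hg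
  have hgm : ∀ n, Measurable (g n) := by
    intro n
    refine measurable_from_prod_countable_left fun s => ?_
    simp only [hg, centredPermSum]
    fun_prop
  have key := ae_tsum_lt_top_of_indepFun (μ := μ)
    (D := fun ω => ((fun t => a t ω), (fun t => b t ω)))
    ((measurable_pi_lambda _ ham).prodMk (measurable_pi_lambda _ hbm)) hτ hind hgm ?_
  · filter_upwards [key] with ω hω
    refine (tendsto_zero_of_tsum_ofReal_sq four_ne_zero hω.ne).congr fun n => ?_
    simp only [centredPermSum]
    rw [Finset.sum_range, Finset.sum_range]
    ring
  · filter_upwards [ae_exists_sum_pow_four_le ha hK, ae_exists_sum_pow_four_le hb hK']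
      with ω ⟨M, hM0, hM⟩ ⟨M', hM0', hM'⟩
    have hsumm : Summable fun n : ℕ => (48 * (M * M')) * ((n : ℝ) ^ (3 / 2 : ℝ))⁻¹ :=
      (Real.summable_nat_rpow_inv.mpr (by norm_num)).mul_left _
    refine (ENNReal.tsum_le_tsum fun n => ?_).trans_lt hsumm.tsum_ofReal_ne_top.lt_top
    have hsing : ∀ s : Equiv.Perm (Fin n), 
        (μ.map (τ n)) {s} = ENNReal.ofReal (n.factorial : ℝ)⁻¹ := by
      intro s
      rw [Measure.map_apply (hτ n) (measurableSet_singleton s),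
        ENNReal.ofReal_inv_of_pos (by positivity), ENNReal.ofReal_natCast, ← hunif n s]
      rfl
    rw [lintegral_fintype]
    simp only [hg, hsing]
    rw [← Finset.sum_mul, ← ENNReal.ofReal_sum_of_nonneg fun s _ => by positivity,
      ← ENNReal.ofReal_mul (Finset.sum_nonneg fun s _ => by positivity)]
    refine ENNReal.ofReal_le_ofReal ?_
    rcases Nat.eq_zero_or_pos n with rfl | hn
    · simp
    have hn' : (0 : ℝ) < n := by exact_mod_cast hn
    have h4 := sum_centredPermSum_pow_four_le (fun t : Fin n => a t ω) (fun t : Fin n => b t ω)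
    have hMn := hM n
    have hMn' := hM' n
    rw [Finset.sum_range] at hMn hMn'
    have hfac : (0 : ℝ) < n.factorial := by positivity
    have hpow : (n : ℝ) ^ (5 / 4 : ℝ) * (n : ℝ) ^ (5 / 4 : ℝ) * ((n : ℝ) ^ 4)⁻¹
        = ((n : ℝ) ^ (3 / 2 : ℝ))⁻¹ := by
      rw [← Real.rpow_natCast, ← Real.rpow_neg hn'.le, ← Real.rpow_neg hn'.le,
        ← Real.rpow_add hn', ← Real.rpow_add hn']
      norm_num
    simp only [abs_mul, mul_pow, Even.pow_abs (show Even 4 by decide)]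
    rw [← Finset.mul_sum]
    calc (n : ℝ)⁻¹ ^ 4 * (∑ s, centredPermSum (fun t : Fin n => a t ω)
          (fun t : Fin n => b t ω) s ^ 4) * (n.factorial : ℝ)⁻¹
        ≤ (n : ℝ)⁻¹ ^ 4 * (48 * (n.factorial : ℝ) *
          ((M * (n : ℝ) ^ (5 / 4 : ℝ)) * (M' * (n : ℝ) ^ (5 / 4 : ℝ)))) * (n.factorial : ℝ)⁻¹ := by
          gcongr
          refine h4.trans ?_
          gcongr
      _ = 48 * (M * M') *
          ((n : ℝ) ^ (5 / 4 : ℝ) * (n : ℝ) ^ (5 / 4 : ℝ) * ((n : ℝ) ^ 4)⁻¹) := by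
          field_simp
      _ = _ := by rw [hpow]

end PermutedAverage

/-! ### The averages occurring in the reference and the permuted sums -/

section Averages

variable {Ω : Type*} [MeasurableSpace Ω] {μ : Measure Ω}

lemma integrable_pow_four {X : Ω → ℝ} {K : ℝ≥0} (hX : Measurable X)
    (h : ∫⁻ ω, ‖X ω‖ₑ ^ 4 ∂μ ≤ K) : Integrable (fun ω => X ω ^ 4) μ := by
  refine ⟨(hX.pow_const 4).aestronglyMeasurable, ?_⟩
  refine lt_of_le_of_lt ?_ (ENNReal.coe_lt_top (r := K))
  simpa [HasFiniteIntegral, enorm_pow] using h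

lemma integral_pow_four_le {X : Ω → ℝ} {K : ℝ≥0} (hX : Measurable X)
    (h : ∫⁻ ω, ‖X ω‖ₑ ^ 4 ∂μ ≤ K) : ∫ ω, X ω ^ 4 ∂μ ≤ K := by
  rw [integral_eq_lintegral_of_nonneg_ae (ae_of_all _ fun ω => by positivity)
    (hX.pow_const 4).aestronglyMeasurable]
  refine ENNReal.toReal_le_coe_of_le_coe (le_trans (le_of_eq ?_) h)
  refine lintegral_congr fun ω => ?_
  rw [← enorm_pow, Real.enorm_of_nonneg (by positivity)]

variable [IsProbabilityMeasure μ]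

lemma memLp_two_of_pow_four {X : Ω → ℝ} (hX : Measurable X)
    (h : Integrable (fun ω => X ω ^ 4) μ) : MemLp X 2 μ := by
  rw [memLp_two_iff_integrable_sq hX.aestronglyMeasurable]
  refine ((integrable_const (1 : ℝ)).add h).mono' (hX.pow_const 2).aestronglyMeasurable
    (ae_of_all _ fun ω => ?_)
  rw [Real.norm_of_nonneg (sq_nonneg _)]
  simp only [Pi.add_apply]
  nlinarith [sq_nonneg (X ω ^ 2 - 1)]

lemma integral_sq_le_one_add {X : Ω → ℝ} {K : ℝ} (hX : Measurable X)
    (h : Integrable (fun ω => X ω ^ 4) μ) (hK : ∫ ω, X ω ^ 4 ∂μ ≤ K) :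
    ∫ ω, X ω ^ 2 ∂μ ≤ 1 + K := by
  have h1 : ∫ ω, X ω ^ 2 ∂μ ≤ ∫ ω, (1 + X ω ^ 4) ∂μ :=
    integral_mono (memLp_two_of_pow_four hX h).integrable_sq ((integrable_const _).add h)
      fun ω => by nlinarith [sq_nonneg (X ω ^ 2 - 1)]
  rw [integral_add (integrable_const _) h] at h1
  simp at h1
  linarith

lemma abs_integral_le_two_add {X : Ω → ℝ} {K : ℝ} (hX : Measurable X)
    (h : Integrable (fun ω => X ω ^ 4) μ) (hK : ∫ ω, X ω ^ 4 ∂μ ≤ K) :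
    |∫ ω, X ω ∂μ| ≤ 2 + K := by
  have h2 := memLp_two_of_pow_four hX h
  have h1 : ∫ ω, |X ω| ∂μ ≤ ∫ ω, (1 + X ω ^ 2) ∂μ :=
    integral_mono (h2.integrable one_le_two).abs ((integrable_const _).add h2.integrable_sq)
      fun ω => by
        simp only []
        nlinarith [sq_nonneg (|X ω| - 1), sq_abs (X ω), abs_nonneg (X ω)]
  rw [integral_add (integrable_const _) h2.integrable_sq] at h1
  have h3 := integral_sq_le_one_add hX h hK
  have h4 := abs_integral_le_integral_abs (f := X) (μ := μ)
  simp at h1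
  linarith

/-- The strong law for sequences whose terms are independent at distance at least `ℓ`. -/
lemma ae_tendsto_average_sub_mean {X : ℕ → Ω → ℝ} {K : ℝ} {ℓ : ℕ}
    (hm : ∀ t, Measurable (X t)) (h4 : ∀ t, Integrable (fun ω => X t ω ^ 4) μ)
    (hK : ∀ t, ∫ ω, X t ω ^ 4 ∂μ ≤ K)
    (hind : ∀ s t : ℕ, (ℓ : ℤ) ≤ |(s : ℤ) - t| → IndepFun (X s) (X t) μ) :
    ∀ᵐ ω ∂μ, Tendsto (fun n : ℕ => (n : ℝ)⁻¹ * ∑ t ∈ Finset.range n, X t ω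
      - (n : ℝ)⁻¹ * ∑ t ∈ Finset.range n, ∫ ω', X t ω' ∂μ) atTop (𝓝 0) := by
  have h2 : ∀ t, MemLp (X t) 2 μ := fun t => memLp_two_of_pow_four (hm t) (h4 t)
  have h1 : ∀ t, Integrable (X t) μ := fun t => (h2 t).integrable one_le_two
  have key := ae_tendsto_average_zero (μ := μ) (X := fun t ω => X t ω - ∫ ω', X t ω' ∂μ)
    (C := 1 + K) (ℓ := ℓ) (fun t => (h2 t).sub (memLp_const _)) ?_ ?_
  · filter_upwards [key] with ω hω
    refine hω.congr fun n => ?_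
    rw [Finset.sum_sub_distrib, mul_sub]
  · intro t
    rw [← variance_eq_integral (hm t).aemeasurable]
    exact (variance_le_expectation_sq (hm t).aestronglyMeasurable).trans
      (integral_sq_le_one_add (hm t) (h4 t) (hK t))
  · intro s t hst
    have hi : IndepFun (fun ω => X s ω - ∫ ω', X s ω' ∂μ) (fun ω => X t ω - ∫ ω', X t ω' ∂μ) μ :=
      (hind s t hst).comp (measurable_id.sub_const _) (measurable_id.sub_const _)
    have h3 := hi.integral_mul_eq_mul_integral
      ((hm s).sub_const _).aestronglyMeasurable ((hm t).sub_const _).aestronglyMeasurable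
    simp only [Pi.mul_apply] at h3
    rw [h3, integral_sub (h1 s) (integrable_const _)]
    simp

lemma abs_average_le {α : ℕ → ℝ} {C : ℝ} (hα : ∀ t, |α t| ≤ C) (n : ℕ) :
    |(n : ℝ)⁻¹ * ∑ t ∈ Finset.range n, α t| ≤ C := by
  have hC : 0 ≤ C := (abs_nonneg _).trans (hα 0)
  rcases Nat.eq_zero_or_pos n with rfl | hn
  · simpa using hC
  have hn' : (0 : ℝ) < n := by exact_mod_cast hn
  rw [abs_mul, abs_of_pos (inv_pos.mpr hn'), inv_mul_le_iff₀ hn']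
  refine (Finset.abs_sum_le_sum_abs _ _).trans ?_
  refine (Finset.sum_le_sum fun t _ => hα t).trans ?_
  simp

/-- Two bounded sequences of means whose products vanish at distance at least `ℓ`: either the
first is zero or the second has finite support, so that the product of the averages vanishes in
the limit. -/
lemma tendsto_mul_zero_of_means {α β x y : ℕ → ℝ} {C C' : ℝ} {ℓ : ℕ}
    (hα : ∀ t, |α t| ≤ C) (hβ : ∀ t, |β t| ≤ C')
    (hαβ : ∀ i j : ℕ, (ℓ : ℤ) ≤ |(i : ℤ) - j| → α i * β j = 0)
    (hx : Tendsto (fun n : ℕ => x n - (n : ℝ)⁻¹ * ∑ t ∈ Finset.range n, α t) atTop (𝓝 0))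
    (hy : Tendsto (fun n : ℕ => y n - (n : ℝ)⁻¹ * ∑ t ∈ Finset.range n, β t) atTop (𝓝 0)) :
    Tendsto (fun n => x n * y n) atTop (𝓝 0) := by
  have hbdd : ∀ (γ z : ℕ → ℝ) (c : ℝ), (∀ t, |γ t| ≤ c) →
      Tendsto (fun n : ℕ => z n - (n : ℝ)⁻¹ * ∑ t ∈ Finset.range n, γ t) atTop (𝓝 0) →
      ∀ᶠ n in atTop, |z n| ≤ 1 + c := by
    intro γ z c hγ hz
    filter_upwards [hz.abs.eventually_lt_const (u := 1) (by simp)] with n hn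
    have h1 := abs_average_le hγ n
    have h2 := abs_add_le (z n - (n : ℝ)⁻¹ * ∑ t ∈ Finset.range n, γ t)
      ((n : ℝ)⁻¹ * ∑ t ∈ Finset.range n, γ t)
    rw [sub_add_cancel] at h2
    linarith
  by_cases h : ∃ i, α i ≠ 0
  · obtain ⟨i, hi⟩ := h
    have hβ0 : Tendsto β atTop (𝓝 0) := by
      refine tendsto_const_nhds.congr' ?_
      filter_upwards [eventually_ge_atTop (i + ℓ)] with j hj
      refine ((mul_eq_zero.mp (hαβ i j ?_)).resolve_left hi).symm
      rw [abs_sub_comm]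
      exact le_trans (by omega) (le_abs_self _)
    have hy0 : Tendsto y atTop (𝓝 0) := by
      simpa using hy.add hβ0.cesaro
    exact bdd_le_mul_tendsto_zero' _ (hbdd α x C hα hx) hy0
  · push Not at h
    have hx0 : Tendsto x atTop (𝓝 0) := by simpa [h] using hx
    simpa only [mul_comm] using bdd_le_mul_tendsto_zero' _ (hbdd β y C' hβ hy) hx0

/-- Permuted averages of two sequences, each independent at distance at least `ℓ`, vanish in the
limit as soon as the products of the means do so at distance at least `ℓ`. -/
theorem ae_tendsto_permuted_average_zero {a b : ℕ → Ω → ℝ} {K K' : ℝ≥0} {ℓ : ℕ}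
    (ham : ∀ t, Measurable (a t)) (hbm : ∀ t, Measurable (b t))
    (ha4 : ∀ t, ∫⁻ ω, ‖a t ω‖ₑ ^ 4 ∂μ ≤ K) (hb4 : ∀ t, ∫⁻ ω, ‖b t ω‖ₑ ^ 4 ∂μ ≤ K')
    (hai : ∀ s t : ℕ, (ℓ : ℤ) ≤ |(s : ℤ) - t| → IndepFun (a s) (a t) μ)
    (hbi : ∀ s t : ℕ, (ℓ : ℤ) ≤ |(s : ℤ) - t| → IndepFun (b s) (b t) μ)
    (hab : ∀ i j : ℕ, (ℓ : ℤ) ≤ |(i : ℤ) - j| → (∫ ω, a i ω ∂μ) * ∫ ω, b j ω ∂μ = 0)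
    {τ : (n : ℕ) → Ω → Equiv.Perm (Fin n)} (hτ : ∀ n, Measurable (τ n))
    (hunif : ∀ n (s : Equiv.Perm (Fin n)), μ {ω | τ n ω = s} = ((n.factorial : ℕ) : ℝ≥0∞)⁻¹)
    (hind : ∀ n, IndepFun (fun ω => ((fun t => a t ω), (fun t => b t ω))) (τ n) μ) :
    ∀ᵐ ω ∂μ, Tendsto (fun n : ℕ => (n : ℝ)⁻¹ * ∑ t : Fin n, a t ω * b (τ n ω t) ω)
      atTop (𝓝 0) := by
  have ha := fun t => integrable_pow_four (ham t) (ha4 t)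
  have hb := fun t => integrable_pow_four (hbm t) (hb4 t)
  have hK := fun t => integral_pow_four_le (ham t) (ha4 t)
  have hK' := fun t => integral_pow_four_le (hbm t) (hb4 t)
  filter_upwards [ae_tendsto_permuted_average ham hbm ha hK hb hK' hτ hunif hind,
    ae_tendsto_average_sub_mean ham ha hK hai, ae_tendsto_average_sub_mean hbm hb hK' hbi]
    with ω h1 h2 h3
  have h4 := tendsto_mul_zero_of_means
    (fun t => abs_integral_le_two_add (ham t) (ha t) (hK t))
    (fun t => abs_integral_le_two_add (hbm t) (hb t) (hK' t)) hab h2 h3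
  simpa using h1.add h4

end Averages

section Model

variable {Ω : Type*} [MeasurableSpace Ω] {μ : Measure Ω} {d : ℕ}

lemma lintegral_coord_le {f : Ω → Vec d} {K : ℝ≥0}
    (h : ∫⁻ ω, ‖f ω‖ₑ ^ 4 ∂μ ≤ K) (k : Fin d) : ∫⁻ ω, ‖f ω k‖ₑ ^ 4 ∂μ ≤ K := by
  refine (lintegral_mono fun ω => ?_).trans h
  gcongr
  exact enorm_le_iff_norm_le.mpr (PiLp.norm_apply_le (f ω) k)

lemma measurable_coord (k : Fin d) : Measurable fun x : Vec d => x k := by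
  fun_prop

lemma LIndep.indepFun_coord {X : ℕ → Ω → Vec d} {ℓ : ℕ} (h : LIndep ℓ X μ) (k : Fin d)
    (s t : ℕ) (hst : (ℓ : ℤ) ≤ |(s : ℤ) - t|) :
    IndepFun (fun ω => X s ω k) (fun ω => X t ω k) μ :=
  (h s).comp (measurable_coord k)
    ((measurable_coord k).comp
      (measurable_pi_apply (⟨t, hst⟩ : {k : ℕ // (ℓ : ℤ) ≤ |(s : ℤ) - (k : ℤ)|})))

variable {φ ψ : ℕ → Ω → Vec d} {W : ℕ → Ω → ℝ} {V : Mat d}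
  {R : ℕ → Ω → Mat d} {m : ℕ} [NeZero m] {σ : (n : ℕ) → PertIdx m → Ω → Equiv.Perm (Fin n)}
  {π : ℕ → Ω → Equiv.Perm (Fin m)} {ℓ : ℕ} {κ : ℝ≥0}

lemma NoiseAssumption.lintegral_eq (h : NoiseAssumption W μ) (t : ℕ) :
    ∫⁻ ω, ‖W t ω‖ₑ ^ 4 ∂μ = ∫⁻ ω, ‖W 0 ω‖ₑ ^ 4 ∂μ :=
  ((h.identDistrib t).comp (u := fun x : ℝ => ‖x‖ₑ ^ 4) (by fun_prop)).lintegral_eq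

lemma NoiseAssumption.lintegral_le (h : NoiseAssumption W μ) (t : ℕ) :
    ∫⁻ ω, ‖W t ω‖ₑ ^ 4 ∂μ ≤ ((∫⁻ ω, ‖W 0 ω‖ₑ ^ 4 ∂μ).toNNReal : ℝ≥0) := by
  rw [h.lintegral_eq t, ENNReal.coe_toNNReal h.fourth_moment.ne]

lemma NoiseAssumption.indepFun (h : NoiseAssumption W μ) (s t : ℕ)
    (hst : ((max ℓ 1 : ℕ) : ℤ) ≤ |(s : ℤ) - t|) : IndepFun (W s) (W t) μ := by
  refine h.indep.indepFun ?_
  rintro rfl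
  simp at hst

lemma CoRegressorNoiseAssumption.indepFun (h : CoRegressorNoiseAssumption ℓ κ ψ W μ) (k : Fin d)
    (s t : ℕ) : IndepFun (fun ω => ψ s ω k) (W t) μ :=
  h.indep_noise.comp ((measurable_coord k).comp (measurable_pi_apply s)) (measurable_pi_apply t)

/-- As `ψ_t` and `W_t` are independent, `E[ψ_t W_t] = 0` says that one of them has mean zero. -/
lemma mean_mul_mean_noise [IsProbabilityMeasure μ] (h1 : NoiseAssumption W μ)
    (h3 : CoRegressorNoiseAssumption ℓ κ ψ W μ)
    (k : Fin d) (i j : ℕ) : (∫ ω, ψ i ω k ∂μ) * ∫ ω, W j ω ∂μ = 0 := by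
  have hmψ : Measurable fun ω => ψ i ω k := (measurable_coord k).comp (h3.measurable i)
  have hψ := (memLp_two_of_pow_four hmψ
    (integrable_pow_four hmψ (lintegral_coord_le (h3.fourth_moment i) k))).integrable one_le_two
  have hW := (memLp_two_of_pow_four (h1.measurable i)
    (integrable_pow_four (h1.measurable i) (h1.lintegral_le i))).integrable one_le_two
  have hprod := (h3.indepFun k i i).integral_mul_eq_mul_integral
    hψ.aestronglyMeasurable hW.aestronglyMeasurable
  have hcoord : ∀ l, Integrable (fun ω => (W i ω • ψ i ω) l) μ := by
    intro l
    have hml : Measurable fun ω => ψ i ω l := (measurable_coord l).comp (h3.measurable i)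
    exact (memLp_two_of_pow_four (h1.measurable i)
      (integrable_pow_four (h1.measurable i) (h1.lintegral_le i))).integrable_mul
      (memLp_two_of_pow_four hml
        (integrable_pow_four hml (lintegral_coord_le (h3.fourth_moment i) l)))
  have hz : ∫ ω, W i ω * ψ i ω k ∂μ = 0 := by
    have h := congrArg (fun v : Vec d => v k) (h3.uncorrelated i)
    simp only [PiLp.zero_apply] at h
    rw [← h, eval_integral_piLp hcoord]
    simp
  have hji : ∫ ω, W j ω ∂μ = ∫ ω, W i ω ∂μ :=
    ((h1.identDistrib j).trans (h1.identDistrib i).symm).integral_eq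
  rw [hji, ← hprod, ← hz]
  exact integral_congr_ae (ae_of_all _ fun ω => mul_comm _ _)

/-- The noise term `(1/n) ∑ ψ_t W_t` of the reference sum vanishes in the limit. -/
theorem ae_tendsto_noise_average [IsProbabilityMeasure μ] (h1 : NoiseAssumption W μ)
    (h3 : CoRegressorNoiseAssumption ℓ κ ψ W μ) (k : Fin d) :
    ∀ᵐ ω ∂μ, Tendsto (fun n : ℕ => (n : ℝ)⁻¹ * ∑ t ∈ Finset.range n, ψ t ω k * W t ω)
      atTop (𝓝 0) := by
  have hmψ : ∀ t, Measurable fun ω => ψ t ω k := fun t =>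
    (measurable_coord k).comp (h3.measurable t)
  have hψ4 := fun t => lintegral_coord_le (h3.fourth_moment t) k
  have hψ2 : ∀ t, MemLp (fun ω => ψ t ω k) 2 μ := fun t =>
    memLp_two_of_pow_four (hmψ t) (integrable_pow_four (hmψ t) (hψ4 t))
  have hW2 : ∀ t, MemLp (W t) 2 μ := fun t =>
    memLp_two_of_pow_four (h1.measurable t)
      (integrable_pow_four (h1.measurable t) (h1.lintegral_le t))
  have hsq : ∀ t, IndepFun (fun ω => ψ t ω k ^ 2) (fun ω => W t ω ^ 2) μ := fun t =>
    (h3.indepFun k t t).comp (φ := fun x : ℝ => x ^ 2) (ψ := fun x : ℝ => x ^ 2)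
      (by fun_prop) (by fun_prop)
  set KW : ℝ≥0 := (∫⁻ ω, ‖W 0 ω‖ₑ ^ 4 ∂μ).toNNReal
  refine ae_tendsto_average_zero (ℓ := max ℓ 1) (C := (1 + κ) * (1 + KW)) ?_ ?_ ?_
  · intro t
    refine (memLp_two_iff_integrable_sq
      ((hmψ t).mul (h1.measurable t)).aestronglyMeasurable).mpr ?_
    simp only [Pi.mul_apply, mul_pow]
    exact (hsq t).integrable_mul (hψ2 t).integrable_sq (hW2 t).integrable_sq
  · intro t
    simp only [mul_pow]
    have h := (hsq t).integral_mul_eq_mul_integral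
      (hψ2 t).integrable_sq.aestronglyMeasurable (hW2 t).integrable_sq.aestronglyMeasurable
    simp only [Pi.mul_apply] at h
    rw [h]
    exact mul_le_mul
      (integral_sq_le_one_add (hmψ t) (integrable_pow_four (hmψ t) (hψ4 t))
        (integral_pow_four_le (hmψ t) (hψ4 t)))
      (integral_sq_le_one_add (h1.measurable t)
        (integrable_pow_four (h1.measurable t) (h1.lintegral_le t))
        (integral_pow_four_le (h1.measurable t) (h1.lintegral_le t)))
      (integral_nonneg fun ω => sq_nonneg _) (by positivity)
  · intro s t hst
    have hst' : (ℓ : ℤ) ≤ |(s : ℤ) - t| := le_trans (by exact_mod_cast le_max_left _ _) hst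
    have hpair : IndepFun (fun ω => ψ s ω k * ψ t ω k) (fun ω => W s ω * W t ω) μ :=
      h3.indep_noise.comp (φ := fun x : ℕ → Vec d => x s k * x t k)
        (ψ := fun x : ℕ → ℝ => x s * x t) (by fun_prop) (by fun_prop)
    have e1 := hpair.integral_mul_eq_mul_integral
      ((hmψ s).mul (hmψ t)).aestronglyMeasurable
      ((h1.measurable s).mul (h1.measurable t)).aestronglyMeasurable
    have e2 := (h3.lIndep.indepFun_coord k s t hst').integral_mul_eq_mul_integral
      (hmψ s).aestronglyMeasurable (hmψ t).aestronglyMeasurable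
    have e3 := (h1.indepFun s t hst).integral_mul_eq_mul_integral
      (h1.measurable s).aestronglyMeasurable (h1.measurable t).aestronglyMeasurable
    simp only [Pi.mul_apply] at e1 e2 e3
    calc ∫ ω, ψ s ω k * W s ω * (ψ t ω k * W t ω) ∂μ
        = ∫ ω, ψ s ω k * ψ t ω k * (W s ω * W t ω) ∂μ := by
          congr 1; funext ω; ring
      _ = ((∫ ω, ψ s ω k ∂μ) * ∫ ω, W s ω ∂μ) * ((∫ ω, ψ t ω k ∂μ) * ∫ ω, W t ω ∂μ) := by
          rw [e1, e2, e3]; ring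
      _ = 0 := by rw [mean_mul_mean_noise h1 h3, zero_mul]

/-- The noise term of a permuted sum vanishes in the limit. -/
theorem ae_tendsto_permuted_noise_average [IsProbabilityMeasure μ] (h1 : NoiseAssumption W μ)
    (h3 : CoRegressorNoiseAssumption ℓ κ ψ W μ) (hσ : RandomizationAssumption φ ψ W R σ π μ)
    (i : PertIdx m) (k : Fin d) :
    ∀ᵐ ω ∂μ, Tendsto (fun n : ℕ => (n : ℝ)⁻¹ * ∑ t : Fin n, ψ t ω k * W (σ n i ω t) ω)
      atTop (𝓝 0) := by
  refine ae_tendsto_permuted_average_zero (a := fun t ω => ψ t ω k) (b := W) (ℓ := max ℓ 1)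
    (fun t => (measurable_coord k).comp (h3.measurable t)) h1.measurable
    (fun t => lintegral_coord_le (h3.fourth_moment t) k) h1.lintegral_le ?_
    (fun s t => h1.indepFun s t) (fun s t _ => mean_mul_mean_noise h1 h3 k s t)
    (fun n => hσ.measurable_perm n i) (fun n => hσ.uniform_perm n i) fun n => ?_
  · intro s t hst
    exact h3.lIndep.indepFun_coord k s t (le_trans (by exact_mod_cast le_max_left _ _) hst)
  · exact (hσ.indep_data n).comp
      (φ := fun x : (ℕ → Vec d) × (ℕ → Vec d) × (ℕ → ℝ) × (ℕ → Fin d → Fin d → ℝ) =>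
        ((fun t => x.2.1 t k), (fun t => x.2.2.1 t)))
      (ψ := fun x : (PertIdx m → Equiv.Perm (Fin n)) × Equiv.Perm (Fin m) => x.1 i)
      (by fun_prop) ((measurable_pi_apply i).comp measurable_fst)

/-- The permuted covariances `(1/n) ∑ ψ_t φ_{σ(t)}ᵀ` vanish in the limit. -/
theorem ae_tendsto_permuted_covariance [IsProbabilityMeasure μ] (h2 : RegressorAssumption ℓ κ φ μ)
    (h3 : CoRegressorNoiseAssumption ℓ κ ψ W μ)
    (h4 : CoRegressorRegressorAssumption ℓ κ φ ψ V μ)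
    (hσ : RandomizationAssumption φ ψ W R σ π μ) (i : PertIdx m) (k l : Fin d) :
    ∀ᵐ ω ∂μ, Tendsto (fun n : ℕ => (n : ℝ)⁻¹ * ∑ t : Fin n, ψ t ω k * φ (σ n i ω t) ω l)
      atTop (𝓝 0) := by
  refine ae_tendsto_permuted_average_zero (a := fun t ω => ψ t ω k) (b := fun t ω => φ t ω l)
    (ℓ := ℓ) (fun t => (measurable_coord k).comp (h3.measurable t))
    (fun t => (measurable_coord l).comp (h2.measurable t))
    (fun t => lintegral_coord_le (h3.fourth_moment t) k)
    (fun t => lintegral_coord_le (h2.fourth_moment t) l)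
    (h3.lIndep.indepFun_coord k) (h2.lIndep.indepFun_coord l) ?_
    (fun n => hσ.measurable_perm n i) (fun n => hσ.uniform_perm n i) fun n => ?_
  · intro s t hst
    have hi : IndepFun (fun ω => ψ s ω k) (fun ω => φ t ω l) μ :=
      (h4.indep s t hst).comp (measurable_coord k) (measurable_coord l)
    have h := hi.integral_mul_eq_mul_integral
      ((measurable_coord k).comp (h3.measurable s)).aestronglyMeasurable
      ((measurable_coord l).comp (h2.measurable t)).aestronglyMeasurable
    rw [← h]
    exact h4.uncorrelated s t hst k l
  · exact (hσ.indep_data n).comp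
      (φ := fun x : (ℕ → Vec d) × (ℕ → Vec d) × (ℕ → ℝ) × (ℕ → Fin d → Fin d → ℝ) =>
        ((fun t => x.2.1 t k), (fun t => x.1 t l)))
      (ψ := fun x : (PertIdx m → Equiv.Perm (Fin n)) × Equiv.Perm (Fin m) => x.1 i)
      (by fun_prop) ((measurable_pi_apply i).comp measurable_fst)

end Model

/-! ### Uniform comparison of the reference sum with the permuted sums -/

section Deterministic

variable {d : ℕ}

open scoped MatrixOrder in
lemma sqrt_isHermitian (S : Mat d) : (CFC.sqrt S).IsHermitian :=
  (Matrix.nonneg_iff_posSemidef.mp (CFC.sqrt_nonneg S)).isHermitian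

open scoped MatrixOrder in
lemma sqrt_mul_sqrt {S : Mat d} (hS : S.PosSemidef) : CFC.sqrt S * CFC.sqrt S = S :=
  CFC.sqrt_mul_sqrt_self S (Matrix.nonneg_iff_posSemidef.mpr hS)

lemma norm_toEuclideanCLM_sq (A : Mat d) (x : Vec d) :
    ‖Matrix.toEuclideanCLM (𝕜 := ℝ) A x‖ ^ 2
      = inner ℝ x (Matrix.toEuclideanCLM (𝕜 := ℝ) (star A * A) x) := by
  rw [map_mul, map_star, ContinuousLinearMap.star_eq_adjoint]
  have := ContinuousLinearMap.apply_norm_sq_eq_inner_adjoint_right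
    (Matrix.toEuclideanCLM (𝕜 := ℝ) A) x
  simpa using this

lemma inner_toEuclideanCLM_le (A : Mat d) (x : Vec d) :
    inner ℝ x (Matrix.toEuclideanCLM (𝕜 := ℝ) A x)
      ≤ ‖Matrix.toEuclideanCLM (𝕜 := ℝ) A‖ * ‖x‖ ^ 2 := by
  refine (real_inner_le_norm _ _).trans ?_
  have := (Matrix.toEuclideanCLM (𝕜 := ℝ) A).le_opNorm x
  nlinarith [norm_nonneg x]

lemma continuous_toEuclideanCLM :
    Continuous (Matrix.toEuclideanCLM (𝕜 := ℝ) : Mat d → Vec d →L[ℝ] Vec d) :=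
  LinearMap.continuous_of_finiteDimensional
    ((Matrix.toEuclideanCLM (𝕜 := ℝ) (n := Fin d)).toAlgEquiv.toLinearMap)

/-- The square of the norm of `S^{-1/2} x` is at most `‖S⁻¹‖ ‖x‖²`. -/
lemma norm_invSqrt_sq_le {S : Mat d} (hS : S.PosSemidef) (x : Vec d) :
    ‖Matrix.toEuclideanCLM (𝕜 := ℝ) (invSqrt S) x‖ ^ 2
      ≤ ‖Matrix.toEuclideanCLM (𝕜 := ℝ) S⁻¹‖ * ‖x‖ ^ 2 := by
  have h : star (invSqrt S) * invSqrt S = S⁻¹ := by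
    rw [invSqrt, Matrix.star_eq_conjTranspose, Matrix.conjTranspose_nonsing_inv,
      (sqrt_isHermitian S).eq, ← Matrix.mul_inv_rev, sqrt_mul_sqrt hS]
  rw [norm_toEuclideanCLM_sq, h]
  exact inner_toEuclideanCLM_le _ _

open scoped MatrixOrder in
/-- For nonsingular `S`, the square of the norm of `x = S^{1/2} (S^{-1/2} x)` is at most
`‖S‖ ‖S^{-1/2} x‖²`. -/
lemma norm_sq_le_invSqrt {S : Mat d} (hS : S.PosSemidef) (hdet : S.det ≠ 0) (x : Vec d) :
    ‖x‖ ^ 2 ≤ ‖Matrix.toEuclideanCLM (𝕜 := ℝ) S‖ *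
      ‖Matrix.toEuclideanCLM (𝕜 := ℝ) (invSqrt S) x‖ ^ 2 := by
  have hu : IsUnit (CFC.sqrt S).det := by
    rw [isUnit_iff_ne_zero]
    intro h0
    apply hdet
    rw [← sqrt_mul_sqrt hS, Matrix.det_mul, h0, zero_mul]
  have hx : Matrix.toEuclideanCLM (𝕜 := ℝ) (CFC.sqrt S)
      (Matrix.toEuclideanCLM (𝕜 := ℝ) (invSqrt S) x) = x := by
    change (Matrix.toEuclideanCLM (𝕜 := ℝ) (CFC.sqrt S) *
      Matrix.toEuclideanCLM (𝕜 := ℝ) (invSqrt S)) x = x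
    rw [← map_mul, invSqrt, Matrix.mul_nonsing_inv _ hu, map_one, one_apply_eq_self]
  have h := norm_toEuclideanCLM_sq (CFC.sqrt S) (Matrix.toEuclideanCLM (𝕜 := ℝ) (invSqrt S) x)
  rw [Matrix.star_eq_conjTranspose, (sqrt_isHermitian S).eq, sqrt_mul_sqrt hS, hx] at h
  rw [h]
  exact inner_toEuclideanCLM_le _ _

/-- If the shaping matrices converge to a positive definite matrix, the norms `‖R_n^{-1/2} x‖` are
eventually equivalent to `‖x‖`, uniformly in `n`. -/
lemma eventually_invSqrt_bounds {R : ℕ → Mat d} {S : Mat d} (hR : ∀ n, (R n).PosSemidef)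
    (hS : S.PosDef) (hlim : Tendsto R atTop (𝓝 S)) :
    ∃ α > 0, ∃ β > 0, ∀ᶠ n in atTop, ∀ x : Vec d,
      α * ‖x‖ ≤ ‖Matrix.toEuclideanCLM (𝕜 := ℝ) (invSqrt (R n)) x‖ ∧
        ‖Matrix.toEuclideanCLM (𝕜 := ℝ) (invSqrt (R n)) x‖ ≤ β * ‖x‖ := by
  have hdet0 : S.det ≠ 0 := hS.det_pos.ne'
  have hdet : Tendsto (fun n => (R n).det) atTop (𝓝 S.det) :=
    ((continuous_id.matrix_det).tendsto S).comp hlim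
  have hadj : Tendsto (fun n => (R n).adjugate) atTop (𝓝 S.adjugate) :=
    ((continuous_id.matrix_adjugate).tendsto S).comp hlim
  have hinv : Tendsto (fun n => (R n)⁻¹) atTop (𝓝 S⁻¹) := by
    simp only [Matrix.inv_def, Ring.inverse_eq_inv']
    exact (hdet.inv₀ hdet0).smul hadj
  have hn1 := ((continuous_toEuclideanCLM.tendsto S).comp hlim).norm
  have hn2 := ((continuous_toEuclideanCLM.tendsto S⁻¹).comp hinv).norm
  set A := ‖Matrix.toEuclideanCLM (𝕜 := ℝ) S‖ + 1 with hA
  set B := ‖Matrix.toEuclideanCLM (𝕜 := ℝ) S⁻¹‖ + 1 with hB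
  have hA0 : 0 < A := by positivity
  have hB0 : 0 < B := by positivity
  refine ⟨(√A)⁻¹, by positivity, √B, by positivity, ?_⟩
  filter_upwards [hn1.eventually_lt_const (lt_add_one _),
    hn2.eventually_lt_const (lt_add_one _), hdet.eventually_ne hdet0] with n h1 h2 h3 x
  constructor
  · rw [inv_mul_le_iff₀ (by positivity)]
    refine le_of_sq_le_sq ?_ (by positivity)
    rw [mul_pow, Real.sq_sqrt hA0.le]
    refine (norm_sq_le_invSqrt (hR n) h3 x).trans ?_
    gcongr
    exact h1.le
  · refine le_of_sq_le_sq ?_ (by positivity)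
    rw [mul_pow, Real.sq_sqrt hB0.le]
    refine (norm_invSqrt_sq_le (hR n) x).trans ?_
    gcongr
    exact h2.le

variable {n : ℕ}

/-- The matrix `(1/n) ∑ ψ_t φ_{τ(t)}ᵀ`. -/
noncomputable def permCov (φ ψ : Fin n → Vec d) (τ : Equiv.Perm (Fin n)) : Mat d :=
  Matrix.of fun k l => (n : ℝ)⁻¹ * ∑ t, ψ t k * φ (τ t) l

/-- The vector `(1/n) ∑ ψ_t w_{τ(t)}`. -/
noncomputable def permNoise (ψ : Fin n → Vec d) (w : Fin n → ℝ) (τ : Equiv.Perm (Fin n)) : Vec d :=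
  WithLp.toLp 2 fun k => (n : ℝ)⁻¹ * ∑ t, ψ t k * w (τ t)

lemma refSum_eq_permSum_one (φ ψ : Fin n → Vec d) (Y : Fin n → ℝ) (S : Mat d) (θ : Vec d) :
    refSum φ ψ Y S θ = permSum φ ψ Y S 1 θ := rfl

lemma permSum_eq (φ ψ : Fin n → Vec d) (Y w : Fin n → ℝ) (S : Mat d) (τ : Equiv.Perm (Fin n))
    (θ θ₀ : Vec d) (hY : ∀ t, Y t = inner ℝ (φ t) θ₀ + w t) :
    permSum φ ψ Y S τ θ = Matrix.toEuclideanCLM (𝕜 := ℝ) (invSqrt S)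
      (Matrix.toEuclideanCLM (𝕜 := ℝ) (permCov φ ψ τ) (θ₀ - θ) + permNoise ψ w τ) := by
  unfold permSum
  congr 1
  ext k
  have h : ∀ t, predErr φ Y θ (τ t) = (∑ l, φ (τ t) l * (θ₀ - θ) l) + w (τ t) := by
    intro t
    have hin : inner ℝ (φ (τ t)) (θ₀ - θ) = ∑ l, φ (τ t) l * (θ₀ - θ) l := by
      simp [PiLp.inner_apply, mul_comm]
    rw [predErr, hY, ← hin, inner_sub_right]
    ring
  simp only [PiLp.add_apply, PiLp.smul_apply, Matrix.ofLp_toEuclideanCLM, Matrix.mulVec,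
    dotProduct, permCov, permNoise, Matrix.of_apply, WithLp.ofLp_sum, Finset.sum_apply,
    WithLp.ofLp_smul, Pi.smul_apply, smul_eq_mul, h]
  simp only [add_mul, Finset.sum_add_distrib, mul_add, Finset.sum_mul, Finset.mul_sum]
  rw [Finset.sum_comm]
  congr 1
  · exact Finset.sum_congr rfl fun l _ => Finset.sum_congr rfl fun t _ => by ring
  · exact Finset.sum_congr rfl fun t _ => by ring

lemma le_rank_of_forall_lt {m : ℕ} [NeZero m] {φ ψ : Fin n → Vec d} {Y : Fin n → ℝ} {S : Mat d}
    {σ : PertIdx m → Equiv.Perm (Fin n)} {π : Equiv.Perm (Fin m)} {θ : Vec d}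
    (h : ∀ i, ‖permSum φ ψ Y S (σ i) θ‖ < ‖refSum φ ψ Y S θ‖) :
    m ≤ rank φ ψ Y S σ π θ := by
  have h1 : ∀ i : PertIdx m, TieGT π 0 i (‖refSum φ ψ Y S θ‖ ^ 2)
      (‖permSum φ ψ Y S (σ i) θ‖ ^ 2) := fun i =>
    Or.inl (pow_lt_pow_left₀ (h i) (norm_nonneg _) two_ne_zero)
  have hcard : Fintype.card (PertIdx m) = m - 1 := by
    simp [PertIdx, Fintype.card_subtype_compl]
  simp only [rank, h1, if_true, Finset.sum_const, Finset.card_univ, hcard, smul_eq_mul, mul_one]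
  omega

lemma exists_pos_mul_norm_le {V : Mat d} (hV : ∀ x : Fin d → ℝ, x ≠ 0 → 0 < x ⬝ᵥ V.mulVec x) :
    ∃ c > 0, ∀ x : Vec d, c * ‖x‖ ≤ ‖Matrix.toEuclideanCLM (𝕜 := ℝ) V x‖ := by
  obtain ⟨K, hK, h⟩ := LinearMap.exists_antilipschitzWith
    (Matrix.toEuclideanCLM (𝕜 := ℝ) V : Vec d →L[ℝ] Vec d).toLinearMap (by
      rw [LinearMap.ker_eq_bot']
      intro x hx
      by_contra hne
      have h0 : x.ofLp ≠ 0 := fun h => hne (by ext k; simp [h])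
      have hpos := hV x.ofLp h0
      have h2 : V.mulVec x.ofLp = 0 := by
        rw [← Matrix.ofLp_toEuclideanCLM]
        exact congrArg WithLp.ofLp hx
      rw [h2] at hpos
      simp at hpos)
  refine ⟨(K : ℝ)⁻¹, by positivity, fun x => ?_⟩
  rw [inv_mul_le_iff₀ (by positivity)]
  simpa using h.le_mul_norm_sub x 0

/-- If the covariance and noise terms of the reference sum converge to a positive definite matrix
and to zero, while all those of the permuted sums converge to zero, then eventually the reference
sum strictly dominates all permuted sums outside a given ball, uniformly in the parameter. -/
theorem eventually_confRegion_subset {m q : ℕ} [NeZero m] (hq : 0 < q) (hqm : q < m)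
    {φ ψ : ℕ → Vec d} {W Y : ℕ → ℝ} {R : ℕ → Mat d} {V S : Mat d} {θ₀ : Vec d}
    {σ : (n : ℕ) → PertIdx m → Equiv.Perm (Fin n)} {π : ℕ → Equiv.Perm (Fin m)}
    (hY : ∀ t, Y t = inner ℝ (φ t) θ₀ + W t)
    (hV : ∀ x : Fin d → ℝ, x ≠ 0 → 0 < x ⬝ᵥ V.mulVec x)
    (hR : ∀ n, (R n).PosSemidef) (hS : S.PosDef) (hlim : Tendsto R atTop (𝓝 S))
    (hcov : Tendsto (fun n => permCov (fun t : Fin n => φ t) (fun t : Fin n => ψ t) 1)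
      atTop (𝓝 V))
    (hnoise : Tendsto (fun n => permNoise (fun t : Fin n => ψ t) (fun t : Fin n => W t) 1)
      atTop (𝓝 0))
    (hpcov : ∀ i, Tendsto (fun n => permCov (fun t : Fin n => φ t) (fun t : Fin n => ψ t) (σ n i))
      atTop (𝓝 0))
    (hpnoise : ∀ i, Tendsto
      (fun n => permNoise (fun t : Fin n => ψ t) (fun t : Fin n => W t) (σ n i)) atTop (𝓝 0))
    {ε : ℝ} (hε : 0 < ε) :
    ∀ᶠ n in atTop, confRegion q (fun t : Fin n => φ t) (fun t : Fin n => ψ t)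
      (fun t : Fin n => Y t) (R n) (σ n) (π n) ⊆ Metric.closedBall θ₀ ε := by
  obtain ⟨α, hα, β, hβ, hαβ⟩ := eventually_invSqrt_bounds hR hS hlim
  obtain ⟨c, hc, hcV⟩ := exists_pos_mul_norm_le hV
  -- chosen such that `δ (α + β) (x + 1) < α c x` for `x > ε`
  set δ := α * c * ε / ((α + β) * (ε + 1)) with hδ
  have hδ0 : 0 < δ := by positivity
  have hδeq : δ * ((α + β) * (ε + 1)) = α * c * ε := div_mul_cancel₀ _ (by positivity)
  have e1 : ∀ᶠ n in atTop, ‖Matrix.toEuclideanCLM (𝕜 := ℝ)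
      (permCov (fun t : Fin n => φ t) (fun t : Fin n => ψ t) 1)
      - Matrix.toEuclideanCLM (𝕜 := ℝ) V‖ < δ := by
    have h := ((continuous_toEuclideanCLM.tendsto V).comp hcov).sub_const
      (Matrix.toEuclideanCLM (𝕜 := ℝ) V)
    rw [sub_self] at h
    exact h.norm.eventually_lt_const (by simpa using hδ0)
  have e2 := hnoise.norm.eventually_lt_const (by simpa using hδ0)
  have e3 : ∀ᶠ n in atTop, ∀ i, ‖Matrix.toEuclideanCLM (𝕜 := ℝ)
      (permCov (fun t : Fin n => φ t) (fun t : Fin n => ψ t) (σ n i))‖ < δ := by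
    refine eventually_all.mpr fun i => ?_
    have h := (continuous_toEuclideanCLM.tendsto 0).comp (hpcov i)
    rw [map_zero] at h
    exact h.norm.eventually_lt_const (by simpa using hδ0)
  have e4 : ∀ᶠ n in atTop, ∀ i, ‖permNoise (fun t : Fin n => ψ t) (fun t : Fin n => W t)
      (σ n i)‖ < δ := eventually_all.mpr fun i =>
    (hpnoise i).norm.eventually_lt_const (by simpa using hδ0)
  filter_upwards [hαβ, e1, e2, e3, e4] with n h0 h1 h2 h3 h4 θ hθ
  rw [Metric.mem_closedBall, dist_comm, dist_eq_norm]
  by_contra! hlt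
  set v := θ₀ - θ with hv
  refine absurd (le_trans (le_rank_of_forall_lt fun i => ?_) hθ) (by omega)
  rw [refSum_eq_permSum_one, permSum_eq _ _ _ (fun t : Fin n => W t) _ _ θ θ₀ fun t => hY t,
    permSum_eq _ _ _ (fun t : Fin n => W t) _ _ θ θ₀ fun t => hY t]
  refine (h0 _).2.trans_lt (lt_of_lt_of_le ?_ (h0 _).1)
  rw [← hv]
  set L := Matrix.toEuclideanCLM (𝕜 := ℝ) V
  set L₀ := Matrix.toEuclideanCLM (𝕜 := ℝ)
    (permCov (fun t : Fin n => φ t) (fun t : Fin n => ψ t) 1)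
  set Lᵢ := Matrix.toEuclideanCLM (𝕜 := ℝ)
    (permCov (fun t : Fin n => φ t) (fun t : Fin n => ψ t) (σ n i))
  set w₀ := permNoise (fun t : Fin n => ψ t) (fun t : Fin n => W t) 1
  set wᵢ := permNoise (fun t : Fin n => ψ t) (fun t : Fin n => W t) (σ n i)
  have hup : ‖Lᵢ v + wᵢ‖ ≤ δ * (‖v‖ + 1) := by
    have := (norm_add_le (Lᵢ v) wᵢ).trans (add_le_add
      (Lᵢ.le_of_opNorm_le (h3 i).le v) (h4 i).le)
    linarith
  have hlow : c * ‖v‖ - δ * (‖v‖ + 1) ≤ ‖L₀ v + w₀‖ := by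
    have e : L v = (L₀ v + w₀) - ((L₀ - L) v + w₀) := by
      simp
    have h5 := hcV v
    have h6 := norm_sub_le (L₀ v + w₀) ((L₀ - L) v + w₀)
    rw [← e] at h6
    have h7 := (norm_add_le ((L₀ - L) v) w₀).trans (add_le_add
      ((L₀ - L).le_of_opNorm_le h1.le v) h2.le)
    linarith
  calc β * ‖Lᵢ v + wᵢ‖ ≤ β * (δ * (‖v‖ + 1)) := by gcongr
    _ < α * (c * ‖v‖ - δ * (‖v‖ + 1)) := by
      have hkey : δ * ((α + β) * (‖v‖ + 1)) * (ε + 1) < α * c * ‖v‖ * (ε + 1) := by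
        have : δ * ((α + β) * (‖v‖ + 1)) * (ε + 1) = α * c * ε * (‖v‖ + 1) := by
          rw [← hδeq]; ring
        rw [this]
        have hαc : 0 < α * c := by positivity
        nlinarith [mul_lt_mul_of_pos_left hlt hαc]
      have := lt_of_mul_lt_mul_right hkey (by positivity)
      linarith
    _ ≤ α * ‖L₀ v + w₀‖ := by gcongr

end Deterministic

end RPS

theorem theorem2 {Ω : Type*} [MeasurableSpace Ω] (μ : Measure Ω) [IsProbabilityMeasure μ]
    (d : ℕ)
    -- the confidence level `p` and the integers `m > q > 0` of the algorithm
    (p : ℚ) (m q : ℕ) [NeZero m] (hq : 0 < q) (hqm : q < m) (hp : p = 1 - (q : ℚ) / (m : ℚ))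
    -- the true parameter, the regressors, co-regressors, noises, outputs
    (θstar : RPS.Vec d) (φ ψ : ℕ → Ω → RPS.Vec d) (W Y : ℕ → Ω → ℝ)
    -- the shaping matrices and the random permutations
    (R : ℕ → Ω → RPS.Mat d) (σ : (n : ℕ) → RPS.PertIdx m → Ω → Equiv.Perm (Fin n))
    (π : ℕ → Ω → Equiv.Perm (Fin m))
    (ℓ : ℕ) (κ : ℝ≥0) (V Rlim : RPS.Mat d)
    (hY : ∀ t ω, Y t ω = inner ℝ (φ t ω) θstar + W t ω)
    (hA1 : RPS.NoiseAssumption W μ)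
    (hA2 : RPS.RegressorAssumption ℓ κ φ μ)
    (hA3 : RPS.CoRegressorNoiseAssumption ℓ κ ψ W μ)
    (hA4 : RPS.CoRegressorRegressorAssumption ℓ κ φ ψ V μ)
    (hA5 : RPS.ShapingAssumption R Rlim W μ)
    (hσπ : RPS.RandomizationAssumption φ ψ W R σ π μ) :
    ∀ ε : ℝ, 0 < ε →
      ∀ᵐ ω ∂μ, ∃ k : ℕ, ∀ n : ℕ, k ≤ n →
        RPS.region q φ ψ Y R σ π n ω ⊆ Metric.closedBall θstar ε := by
  intro ε hε
  have hw : ∀ᵐ ω ∂μ, ∀ k, Tendsto (fun n : ℕ =>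
      (n : ℝ)⁻¹ * ∑ t ∈ Finset.range n, ψ t ω k * W t ω) atTop (𝓝 0) :=
    ae_all_iff.mpr fun k => RPS.ae_tendsto_noise_average hA1 hA3 k
  have hpw : ∀ᵐ ω ∂μ, ∀ i k, Tendsto (fun n : ℕ =>
      (n : ℝ)⁻¹ * ∑ t : Fin n, ψ t ω k * W (σ n i ω t) ω) atTop (𝓝 0) :=
    ae_all_iff.mpr fun i => ae_all_iff.mpr fun k =>
      RPS.ae_tendsto_permuted_noise_average hA1 hA3 hσπ i k
  have hpc : ∀ᵐ ω ∂μ, ∀ i k l, Tendsto (fun n : ℕ =>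
      (n : ℝ)⁻¹ * ∑ t : Fin n, ψ t ω k * φ (σ n i ω t) ω l) atTop (𝓝 0) :=
    ae_all_iff.mpr fun i => ae_all_iff.mpr fun k => ae_all_iff.mpr fun l =>
      RPS.ae_tendsto_permuted_covariance hA2 hA3 hA4 hσπ i k l
  filter_upwards [hA4.tendsto, hA5.tendsto, ae_all_iff.mpr hA5.posSemidef, hw, hpw, hpc]
    with ω hV hR hpsd hw hpw hpc
  have hcov : Tendsto (fun n => RPS.permCov (fun t : Fin n => φ t ω) (fun t : Fin n => ψ t ω) 1)
      atTop (𝓝 V) := by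
    refine hV.congr fun n => ?_
    ext k l
    simp [RPS.covMat, RPS.permCov, Finset.sum_range]
  have h0 : Tendsto (WithLp.toLp 2 : (Fin d → ℝ) → RPS.Vec d) (𝓝 0) (𝓝 0) :=
    (PiLp.continuous_toLp 2 _).tendsto' 0 0 rfl
  have hnoise : Tendsto (fun n => RPS.permNoise (fun t : Fin n => ψ t ω)
      (fun t : Fin n => W t ω) 1) atTop (𝓝 0) := by
    refine h0.comp (tendsto_pi_nhds.mpr fun k => ?_)
    simpa [Finset.sum_range] using hw k
  have hpcov : ∀ i, Tendsto (fun n => RPS.permCov (fun t : Fin n => φ t ω)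
      (fun t : Fin n => ψ t ω) (σ n i ω)) atTop (𝓝 0) := fun i =>
    tendsto_pi_nhds.mpr fun k => tendsto_pi_nhds.mpr fun l => hpc i k l
  have hpnoise : ∀ i, Tendsto (fun n => RPS.permNoise (fun t : Fin n => ψ t ω)
      (fun t : Fin n => W t ω) (σ n i ω)) atTop (𝓝 0) := fun i =>
    h0.comp (tendsto_pi_nhds.mpr fun k => hpw i k)
  have key := RPS.eventually_confRegion_subset (φ := fun t => φ t ω) (ψ := fun t => ψ t ω)
    (W := fun t => W t ω) (Y := fun t => Y t ω) (R := fun n => R n ω) (σ := fun n i => σ n i ω)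
    (π := fun n => π n ω) hq hqm (fun t => hY t ω)
    hA4.limit_pos hpsd hA5.limit_posDef hR hcov hnoise hpcov hpnoise hε
  exact eventually_atTop.mp key
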